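/- **Theorem 1.** *Setting.* Let $\mathcal P$ be a distribution on a context space $\mathcal X$, $\mathcal A$ an action set, $\mathcal F$ a finite class of functions $f:\mathcal X\times\mathcal A\to[-B,B]$, $B>0$. The contexts $x_1,\dots,x_m$ (planning, $m\ge T\ge 1$) and $\tilde x_1,\dots,\tilde x_T$ (sampling) are i.i.d. with law $\mathcal P$. Playing action $\tilde a_t$ on $\tilde x_t$ gives the reward $\tilde r_t=f_\star(\tilde x_t,\tilde a_t)+\xi_t$ with an unknown $f_\star\in\mathcal F$, where, conditionally on everything before it, $\xi_t$ has mean zero and is $1$-subgaussian, and $|\xi_t|\le\bar B$ for a constant $\bar B>0$. For a dataset $\mathcal D$ of context-action pairs let $\|g-h\|_{\mathcal D}^2=\sum_{(x,a)\in\mathcal D}(g(x,a)-h(x,a))^2$. A pair $z\in\mathcal X\times\mathcal A$ is $\eta$-dependent on $\mathcal D$ if all $g,h\in\mathcal F$ with $\|g-h\|_{\mathcal D}\le\eta$ satisfy $g(z)-h(z)\le\eta$; otherwise it is $\eta$-independent of $\mathcal D$. The eluder dimension $d_{\mathrm{eluder}}(\mathcal F,\eta)$ is the largest length, over all $\eta'\ge\eta$,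 of a sequence in $\mathcal X\times\mathcal A$ each element of which is $\eta'$-independent of its predecessors. For a constant $\bar C>0$ and $\delta\in(0,1)$ put $\beta_t=\bar C(B+\bar B)\sqrt{\log(|\mathcal F|t/\delta)}$. *EluderPlanner.* Put $\mathcal D_1=\emptyset$ and for $t=1,\dots,T$ let $$\pi_t(x)\in\arg\max_{a\in\mathcal A}\ \max_{f,f'\in\mathcal F,\ \|f-f'\|_{\mathcal D_t}\le4\beta_t}\bigl(f(x,a)-f'(x,a)\bigr),\qquad \mathcal D_{t+1}=\mathcal D_t\cup\{(x_t,\pi_t(x_t))\}.$$ *Sampler.* For $t=1,\dots,T$ play $\tilde a_t=\pi_t(\tilde x_t)$ on $\tilde x_t$ and observe $\tilde r_t$; let $\widetilde{\mathcal D}_t=\{(\tilde x_\ell,\tilde a_\ell)\}_{\ell<t}$. *Output.* Let $\hat f_t\in\arg\min_{f\in\mathcal F}\sum_{\ell<t}(f(\tilde x_\ell,\tilde a_\ell)-\tilde r_\ell)^2$ and $$\tilde\pi^{\mathrm{opt}}_t(x)\in\arg\max_{a\in\mathcal A}\ \max_{f\in\mathcal F,\ \|\hat f_t-f\|_{\widetilde{\mathcal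 D}_t}\le\beta_t}f(x,a),$$ and let $\hat\pi_T$ be the uniform mixture of $\tilde\pi^{\mathrm{opt}}_1,\dots,\tilde\pi^{\mathrm{opt}}_T$. The maxima over actions are assumed to be attained by measurable policies; ties may be broken by any measurable rule. *Claim.* There are universal constants $\bar C>0$ and $c>0$ such that in every such setting and for every $\epsilon>0$, $\delta\in(0,1)$ and $T\ge1$: if $$T\ \ge\ c\,\frac{\max{}^2(B,\bar B,1)\,\max\{d_{\mathrm{eluder}}(\mathcal F,B/T),\,1\}\,\log(|\mathcal F|T/\delta)}{\epsilon^2},$$ then with probability at least $1-\delta$ the policy $\hat\pi_T$ is $\epsilon$-optimal, that is, for every policy $\pi$ (a map from contexts to distributions over actions) $$\mathbb E_{x\sim\mathcal P,\,a\sim\pi(x)}[f_\star(x,a)]\ \le\ \mathbb E_{x\sim\mathcal P,\,a\sim\hat\pi_T(x)}[f_\star(x,a)]+\epsilon .$$ -/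

import Mathlib

open MeasureTheory ProbabilityTheory
open scoped ENNReal

noncomputable section

namespace EluderPlanning

/-! ### Data norm and eluder dimension of a scalar function class -/

section Eluder

variable {Z : Type*}

/-- The data norm `‖g - h‖_D` of the difference of `g` and `h` over the points `D 0, …, D (n-1)`
(counted with multiplicity). -/
def dataNorm {n : ℕ} (g h : Z → ℝ) (D : Fin n → Z) : ℝ :=
  Real.sqrt (∑ i, (g (D i) - h (D i)) ^ 2)

/-- `z` is `ε`-dependent on the points `D 0, …, D (n-1)` with respect to `G`. -/
def EpsDependent (G : Set (Z → ℝ)) (ε : ℝ) {n : ℕ} (D : Fin n → Z) (z : Z) : Prop :=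
  ∀ g ∈ G, ∀ h ∈ G, dataNorm g h D ≤ ε → g z - h z ≤ ε

/-- A finite sequence, every element of which is `ε`-independent of its predecessors. -/
def IsEluderSequence (G : Set (Z → ℝ)) (ε : ℝ) {n : ℕ} (s : Fin n → Z) : Prop :=
  ∀ i : Fin n, ¬ EpsDependent G ε (fun j : Fin i => s (Fin.castLE i.isLt.le j)) (s i)

/-- The non-monotone `ε`-eluder dimension: the length of a longest sequence of elements, every one
of which is `ε`-independent of its predecessors (`⊤` if there is no bound on the length). -/
def eluderDimBar (G : Set (Z → ℝ)) (ε : ℝ) : ℕ∞ :=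
  ⨆ (n : ℕ) (_ : ∃ s : Fin n → Z, IsEluderSequence G ε s), (n : ℕ∞)

/-- The `ε`-eluder dimension. -/
def eluderDim (G : Set (Z → ℝ)) (ε : ℝ) : ℕ∞ :=
  ⨆ (ε' : ℝ) (_ : ε ≤ ε'), eluderDimBar G ε'

end Eluder

/-! ### The planner, the sampler and the policy extracted from the data

Time is counted from `0`: step `n` is the `(n+1)`-st step, and `n` data points precede it. -/

section Algorithm

variable {X A : Type*}

/-- The confidence radius `β_F(t, δ) = Cbar (B + Bbar) √(log (|F| t / δ))`. -/
def confRadius (Cbar B Bbar : ℝ) (F : Finset (X × A → ℝ)) (δ : ℝ) (t : ℕ) : ℝ :=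
  Cbar * (B + Bbar) * Real.sqrt (Real.log ((F.card : ℝ) * t / δ))

/-- The uncertainty `max {f z - f' z | f, f' ∈ F, ‖f - f'‖_D ≤ r}` at `z = (x, a)`. -/
def uncertainty (F : Finset (X × A → ℝ)) (r : ℝ) {n : ℕ} (D : Fin n → X × A) (z : X × A) : ℝ :=
  sSup {v : ℝ | ∃ f ∈ F, ∃ f' ∈ F, dataNorm f f' D ≤ r ∧ v = f z - f' z}

/-- The optimistic value `max {f z | f ∈ F, ‖fhat - f‖_D ≤ r}` at `z = (x, a)`. -/
def optimisticValue (F : Finset (X × A → ℝ)) (fhat : X × A → ℝ) (r : ℝ) {n : ℕ}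
    (D : Fin n → X × A) (z : X × A) : ℝ :=
  sSup {v : ℝ | ∃ f ∈ F, dataNorm fhat f D ≤ r ∧ v = f z}

/-- A planning rule `plan` maps a dataset of `n` context-action pairs to a deterministic policy.
It is an EluderPlanner rule (for horizon `T` and confidence radii `β`) if that policy picks
an action of maximal uncertainty; ties are broken in an arbitrary measurable way. -/
structure IsEluderPlanner [MeasurableSpace X] [MeasurableSpace A] (F : Finset (X × A → ℝ))
    (β : ℕ → ℝ) (T : ℕ) (plan : (n : ℕ) → (Fin n → X × A) → X → A) : Prop where
  measurable : ∀ n < T, Measurable fun p : (Fin n → X × A) × X => plan n p.1 p.2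
  argmax : ∀ n < T, ∀ (D : Fin n → X × A) (x : X) (a : A),
    uncertainty F (4 * β (n + 1)) D (x, a) ≤ uncertainty F (4 * β (n + 1)) D (x, plan n D x)

/-- The dataset of the planner after `n` steps on the offline contexts `x 0, x 1, …`: the empty
dataset, to which step `n` appends `x n` with the action that the current policy takes there. -/
def planData (plan : (n : ℕ) → (Fin n → X × A) → X → A) (x : ℕ → X) : (n : ℕ) → Fin n → X × A
  | 0 => Fin.elim0
  | n + 1 => Fin.snoc (α := fun _ => X × A) (planData plan x n)
      (x n, plan n (planData plan x n) (x n))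

/-- The exploration policy that the planner outputs for step `n`. -/
def explorationPolicy (plan : (n : ℕ) → (Fin n → X × A) → X → A) (x : ℕ → X) (n : ℕ) : X → A :=
  plan n (planData plan x n)

/-- The dataset of the sampler after `n` steps: the exploration policies are played on the contexts
`xs 0, xs 1, …`, and the rewards are `fstar (context, action) + noise`. -/
def samplerData (plan : (n : ℕ) → (Fin n → X × A) → X → A) (x : ℕ → X) (fstar : X × A → ℝ)
    (xs : ℕ → X) (ξ : ℕ → ℝ) (n : ℕ) : Fin n → (X × A) × ℝ := fun i =>
  ((xs i, explorationPolicy plan x i (xs i)),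
    fstar (xs i, explorationPolicy plan x i (xs i)) + ξ i)

/-- `ls` maps every dataset of context-action-reward triples to a least-squares fit in `F`. -/
def IsLeastSquares (F : Finset (X × A → ℝ))
    (ls : (n : ℕ) → (Fin n → (X × A) × ℝ) → X × A → ℝ) : Prop :=
  ∀ (n : ℕ) (D : Fin n → (X × A) × ℝ), ls n D ∈ F ∧
    ∀ f ∈ F, ∑ i, (ls n D (D i).1 - (D i).2) ^ 2 ≤ ∑ i, (f (D i).1 - (D i).2) ^ 2

/-- `opt` maps a dataset of `n` triples to the optimistic least-squares policy, which picks
an action of maximal optimistic value; ties are broken in an arbitrary measurable way. -/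
structure IsOptimistic [MeasurableSpace X] [MeasurableSpace A] (F : Finset (X × A → ℝ))
    (β : ℕ → ℝ) (T : ℕ) (ls : (n : ℕ) → (Fin n → (X × A) × ℝ) → X × A → ℝ)
    (opt : (n : ℕ) → (Fin n → (X × A) × ℝ) → X → A) : Prop where
  measurable : ∀ n < T, Measurable fun p : (Fin n → (X × A) × ℝ) × X => opt n p.1 p.2
  argmax : ∀ n < T, ∀ (D : Fin n → (X × A) × ℝ) (x : X) (a : A),
    optimisticValue F (ls n D) (β (n + 1)) (fun i => (D i).1) (x, a) ≤
      optimisticValue F (ls n D) (β (n + 1)) (fun i => (D i).1) (x, opt n D x)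

/-- The uniform mixture of the deterministic policies `π 0, …, π (T-1)`. -/
def uniformMixture [MeasurableSpace A] (T : ℕ) (π : ℕ → X → A) (x : X) : Measure A :=
  (T : ℝ≥0∞)⁻¹ • ∑ t ∈ Finset.range T, Measure.dirac (π t x)

/-- The final policy of the eluder planning algorithm: the uniform mixture of the optimistic
policies of steps `0, …, T-1`, that of step `t` being computed from the first `t` triples. -/
def eluderPlanningPolicy [MeasurableSpace A] (plan : (n : ℕ) → (Fin n → X × A) → X → A)
    (opt : (n : ℕ) → (Fin n → (X × A) × ℝ) → X → A) (fstar : X × A → ℝ) (T : ℕ)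
    (x xs : ℕ → X) (ξ : ℕ → ℝ) : X → Measure A :=
  uniformMixture T fun t => opt t (samplerData plan x fstar xs ξ t)

/-- The expected reward `E_{x ∼ P, a ∼ π(x)} [f (x, a)]` of a policy. -/
def policyValue [MeasurableSpace X] [MeasurableSpace A] (P : Measure X) (f : X × A → ℝ)
    (π : X → Measure A) : ℝ :=
  ∫ x, ∫ a, f (x, a) ∂(π x) ∂P

/-- `πhat` is `ε`-optimal among all (randomized) policies. -/
def IsEpsOptimal [MeasurableSpace X] [MeasurableSpace A] (P : Measure X) (f : X × A → ℝ) (ε : ℝ)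
    (πhat : X → Measure A) : Prop :=
  ∀ π : Kernel X A, IsMarkovKernel π → policyValue P f π ≤ policyValue P f πhat + ε

end Algorithm

/-! ### The stochastic environment -/

section Environment

variable {X Ω : Type*} [MeasurableSpace X] [MeasurableSpace Ω]

/-- The information that precedes the noise of step `t`: all `m` offline contexts, the sampling
contexts of the steps `0, …, t`, and the noise of the steps before `t`. The actions of the steps
`0, …, t` and the rewards of the steps before `t` are functions of these. -/
abbrev history (m : ℕ) (x xs : ℕ → Ω → X) (ξ : ℕ → Ω → ℝ) (t : ℕ) : MeasurableSpace Ω :=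
  (⨆ (i : ℕ) (_ : i < m), MeasurableSpace.comap (x i) inferInstance) ⊔
    (⨆ (s : ℕ) (_ : s ≤ t), MeasurableSpace.comap (xs s) inferInstance) ⊔
    (⨆ (s : ℕ) (_ : s < t), MeasurableSpace.comap (ξ s) inferInstance)

/-- The offline contexts `x 0, …, x (m-1)` and the sampling contexts `xs 0, …, xs (T-1)` are
i.i.d. with law `P`, and the noise `ξ 0, …, ξ (T-1)` of the sampling phase is conditionally zero
mean, conditionally 1-subgaussian, and bounded by `Bbar`. -/
structure IsEnvironment (μ : Measure Ω) (P : Measure X) (Bbar : ℝ) (m T : ℕ)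
    (x xs : ℕ → Ω → X) (ξ : ℕ → Ω → ℝ) : Prop where
  measurable_offline : ∀ i < m, Measurable (x i)
  measurable_sampling : ∀ t < T, Measurable (xs t)
  measurable_noise : ∀ t < T, Measurable (ξ t)
  law_offline : ∀ i < m, μ.map (x i) = P
  law_sampling : ∀ t < T, μ.map (xs t) = P
  indep : iIndepFun (fun j : Fin m ⊕ Fin T =>
    Sum.elim (fun i : Fin m => x i) (fun t : Fin T => xs t) j) μ
  noise_bounded : ∀ t < T, ∀ᵐ ω ∂μ, |ξ t ω| ≤ Bbar
  noise_mean : ∀ t < T, μ[ξ t | history m x xs ξ t] =ᵐ[μ] 0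
  noise_subgaussian : ∀ t < T, ∀ l : ℝ,
    ∀ᵐ ω ∂μ, (μ[fun ω' => Real.exp (l * ξ t ω') | history m x xs ξ t]) ω ≤ Real.exp (l ^ 2 / 2)

end Environment

end EluderPlanning

end

open EluderPlanning

/-! At each step the regret of the optimistic policy is dominated, context by context, by the width
of the planner's confidence set at the exploration action. Three high-probability events give this
and bound the total width.

Noise concentration, uniform over `F`, puts the least-squares fit within `β` of `fstar` on the
sampling data, so every function in the confidence set is within `2β` of `fstar` there. The
exploration policy of step `i` depends only on earlier offline contexts. Hence the planner's point
and the sampler's point of step `i` are conditionally i.i.d., and squared distances on planning data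
are at most twice those on sampling data plus a logarithmic term. The optimistic function is
therefore within `4β` of `fstar` on planning data, and the planner's choice of a most uncertain
action bounds its overestimation (`le_add_uncertainty_of_confident`).

Finally, expected widths are at most twice the widths along the offline contexts, up to a logarithm,
and those sum to at most `Tη + O(β²d/η + Bd)` by an eluder-dimension count (`sum_width_le`). Taking
`η = ε/8` gives the rate.

All three events come from exponential supermartingales and Markov's inequality. The factor 2 in the
two comparisons absorbs the second-order terms, so the deviations are logarithmic rather than of
order `√T`. -/

namespace EluderPlanning

/-! ### Eluder dimension and sums of widths -/

section Eluder

variable {Z : Type*}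

/-- The points at which a pair of functions that is close on all predecessors differs by more than
`η` can be coloured with `K` colours so that each of them is witnessed to be `η`-independent of its
predecessors of the same colour. -/
lemma exists_eluder_coloring (G : Set (Z → ℝ)) (z : ℕ → Z) (S : Finset ℕ) {K : ℕ} (hK : 0 < K)
    {η r : ℝ} (hr : r ^ 2 ≤ K * η ^ 2)
    (hS : ∀ k ∈ S, ∃ g ∈ G, ∃ h ∈ G, ∑ j ∈ Finset.range k, (g (z j) - h (z j)) ^ 2 ≤ r ^ 2 ∧
      η < g (z k) - h (z k)) (n : ℕ) :
    ∃ c : ℕ → Fin K, ∀ k < n, k ∈ S → ∃ g ∈ G, ∃ h ∈ G,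
      ∑ j ∈ S with j < k ∧ c j = c k, (g (z j) - h (z j)) ^ 2 ≤ η ^ 2 ∧
        η < g (z k) - h (z k) := by
  induction n with
  | zero => exact ⟨fun _ => ⟨0, hK⟩, fun k hk => absurd hk (Nat.not_lt_zero k)⟩
  | succ n ih =>
    obtain ⟨c, hc⟩ := ih
    by_cases hn : n ∈ S
    · obtain ⟨g, hg, h, hh, hsum, hgt⟩ := hS n hn
      -- Pigeonhole: the `K` colour classes share a total of at most `r² ≤ Kη²`, so one of them
      -- carries at most `η²`.
      obtain ⟨a, -, ha⟩ : ∃ a ∈ (Finset.univ : Finset (Fin K)),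
          ∑ j ∈ S with j < n ∧ c j = a, (g (z j) - h (z j)) ^ 2 ≤ η ^ 2 := by
        refine Finset.exists_le_of_sum_le ⟨⟨0, hK⟩, Finset.mem_univ _⟩ ?_
        have h1 : ∑ a : Fin K, ∑ j ∈ S with j < n ∧ c j = a, (g (z j) - h (z j)) ^ 2
            = ∑ j ∈ S with j < n, (g (z j) - h (z j)) ^ 2 := by
          simp_rw [← Finset.filter_filter]
          exact Finset.sum_fiberwise (S.filter (· < n)) c (fun j => (g (z j) - h (z j)) ^ 2)
        rw [h1]
        calc ∑ j ∈ S with j < n, (g (z j) - h (z j)) ^ 2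
            ≤ ∑ j ∈ Finset.range n, (g (z j) - h (z j)) ^ 2 := by
              refine Finset.sum_le_sum_of_subset_of_nonneg (fun j hj => ?_)
                fun _ _ _ => sq_nonneg _
              simpa using (Finset.mem_filter.1 hj).2
          _ ≤ K * η ^ 2 := hsum.trans hr
          _ = ∑ _a : Fin K, η ^ 2 := by simp
      -- Witnesses of earlier times only involve colours of indices below `n`, so colouring `n`
      -- leaves them intact.
      refine ⟨Function.update c n a, fun k hk hkS => ?_⟩
      rcases Nat.lt_succ_iff_lt_or_eq.1 hk with hlt | rfl
      · obtain ⟨g', hg', h', hh', hsum', hgt'⟩ := hc k hlt hkS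
        refine ⟨g', hg', h', hh', le_trans (le_of_eq ?_) hsum', hgt'⟩
        refine Finset.sum_congr (Finset.filter_congr fun j _ => ?_) fun _ _ => rfl
        refine and_congr_right fun hj => ?_
        rw [Function.update_of_ne (by omega), Function.update_of_ne (by omega)]
      · refine ⟨g, hg, h, hh, le_trans (le_of_eq ?_) ha, hgt⟩
        refine Finset.sum_congr (Finset.filter_congr fun j _ => ?_) fun _ _ => rfl
        refine and_congr_right fun hj => ?_
        rw [Function.update_of_ne (by omega), Function.update_self]
    · refine ⟨c, fun k hk hkS => hc k ?_ hkS⟩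
      rcases Nat.lt_succ_iff_lt_or_eq.1 hk with hlt | rfl
      · exact hlt
      · exact absurd hkS hn

/-- A finite set of times, each point of which is witnessed to be `η`-independent of the preceding
ones, has at most as many elements as the eluder dimension. -/
lemma card_le_eluderDim (G : Set (Z → ℝ)) (z : ℕ → Z) (S : Finset ℕ) {η₀ η : ℝ} (hη : η₀ ≤ η)
    (hη0 : 0 ≤ η)
    (hS : ∀ k ∈ S, ∃ g ∈ G, ∃ h ∈ G, ∑ j ∈ S with j < k, (g (z j) - h (z j)) ^ 2 ≤ η ^ 2 ∧
      η < g (z k) - h (z k)) :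
    (S.card : ℕ∞) ≤ eluderDim G η₀ := by
  let e := S.orderEmbOfFin rfl
  have hs : IsEluderSequence G η (fun i : Fin S.card => z (e i)) := by
    intro i hdep
    obtain ⟨g, hg, h, hh, hsum, hgt⟩ := hS (e i) (S.orderEmbOfFin_mem rfl i)
    refine absurd (hdep g hg h hh ?_) (not_le.2 hgt)
    refine Real.sqrt_le_iff.2 ⟨hη0, le_trans ?_ hsum⟩
    have hinj : Function.Injective fun j : Fin i => e (Fin.castLE i.isLt.le j) :=
      e.injective.comp (Fin.castLE_injective _)
    rw [← Finset.sum_image (s := Finset.univ)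
      (g := fun j : Fin i => e (Fin.castLE i.isLt.le j))
      (f := fun j => (g (z j) - h (z j)) ^ 2) (fun a _ b _ hab => hinj hab)]
    refine Finset.sum_le_sum_of_subset_of_nonneg (fun j hj => ?_) fun _ _ _ => sq_nonneg _
    obtain ⟨a, -, rfl⟩ := Finset.mem_image.1 hj
    refine Finset.mem_filter.2 ⟨S.orderEmbOfFin_mem rfl _, e.strictMono ?_⟩
    exact Fin.lt_def.2 a.isLt
  calc (S.card : ℕ∞) ≤ eluderDimBar G η :=
        le_iSup₂ (f := fun (n : ℕ) (_ : ∃ s : Fin n → Z, IsEluderSequence G η s) => (n : ℕ∞))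
          S.card ⟨_, hs⟩
    _ ≤ eluderDim G η₀ := le_iSup₂ (f := fun (ε' : ℝ) (_ : η₀ ≤ ε') => eluderDimBar G ε') η hη

/-- The number of times at which the width of the confidence set exceeds `η`. -/
lemma card_width_gt_le (G : Set (Z → ℝ)) (z : ℕ → Z) (S : Finset ℕ) {η₀ η r : ℝ} {d : ℕ}
    (hη : η₀ ≤ η) (hη0 : 0 < η) (hr : 0 < r) (hd : eluderDim G η₀ = d)
    (hS : ∀ k ∈ S, ∃ g ∈ G, ∃ h ∈ G, ∑ j ∈ Finset.range k, (g (z j) - h (z j)) ^ 2 ≤ r ^ 2 ∧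
      η < g (z k) - h (z k)) :
    (S.card : ℝ) ≤ (r ^ 2 / η ^ 2 + 1) * d := by
  have hpos : 0 < r ^ 2 / η ^ 2 := by positivity
  -- The least number of colours allowed by the pigeonhole; each colour class is an eluder sequence
  -- at scale `η`, hence has at most `d` elements.
  set K := ⌈r ^ 2 / η ^ 2⌉₊ with hKdef
  have hK : 0 < K := Nat.ceil_pos.2 hpos
  have hrK : r ^ 2 ≤ K * η ^ 2 := (div_le_iff₀ (by positivity)).1 (Nat.le_ceil _)
  obtain ⟨N, hN⟩ := S.exists_nat_subset_range
  obtain ⟨c, hc⟩ := exists_eluder_coloring G z S hK hrK hS N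
  have hcol : ∀ a : Fin K, (S.filter fun j => c j = a).card ≤ d := by
    intro a
    have := card_le_eluderDim G z (S.filter fun j => c j = a) hη hη0.le (fun k hk => ?_)
    · rw [hd] at this
      exact_mod_cast this
    · obtain ⟨hkS, rfl⟩ := Finset.mem_filter.1 hk
      obtain ⟨g, hg, h, hh, hsum, hgt⟩ := hc k (Finset.mem_range.1 (hN hkS)) hkS
      refine ⟨g, hg, h, hh, le_trans (le_of_eq ?_) hsum, hgt⟩
      rw [Finset.filter_filter]
      exact Finset.sum_congr (Finset.filter_congr fun j _ => and_comm) fun _ _ => rfl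
  have hcard : S.card ≤ K * d := by
    rw [Finset.card_eq_sum_card_fiberwise (f := c) (t := Finset.univ) (fun _ _ => by simp)]
    refine (Finset.sum_le_card_nsmul _ _ d fun a _ => hcol a).trans ?_
    simp
  calc (S.card : ℝ) ≤ (K : ℝ) * d := by exact_mod_cast hcard
    _ ≤ (r ^ 2 / η ^ 2 + 1) * d :=
      mul_le_mul_of_nonneg_right (Nat.ceil_lt_add_one hpos.le).le (Nat.cast_nonneg d)

/-- Dyadic decomposition of a number. -/
lemma le_add_sum_dyadic {η w : ℝ} (hη : 0 < η) (J : ℕ) (hw : w ≤ 2 ^ J * η) :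
    w ≤ η + ∑ j ∈ Finset.range J, if 2 ^ j * η < w then 2 ^ j * η else 0 := by
  induction J with
  | zero => simpa using hw
  | succ J ih =>
    rw [Finset.sum_range_succ]
    by_cases h : w ≤ 2 ^ J * η
    · have := ih h
      rw [if_neg (not_lt.2 h)]
      linarith
    · push Not at h
      have h1 : ∀ j ∈ Finset.range J, (if 2 ^ j * η < w then 2 ^ j * η else 0) = 2 ^ j * η := by
        intro j hj
        refine if_pos (lt_of_le_of_lt ?_ h)
        gcongr
        · norm_num
        · exact (Finset.mem_range.1 hj).le
      have h2 : ∑ j ∈ Finset.range J, (2 : ℝ) ^ j = 2 ^ J - 1 := by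
        rw [geom_sum_eq (by norm_num)]; norm_num
      rw [Finset.sum_congr rfl h1, ← Finset.sum_mul, h2, if_pos h]
      rw [pow_succ] at hw
      linarith

/-- The sum of the widths of the confidence sets along any sequence of points. -/
lemma sum_width_le (G : Set (Z → ℝ)) (z : ℕ → Z) (w : ℕ → ℝ) {η₀ η r M : ℝ} {d n : ℕ}
    (hη : η₀ ≤ η) (hη0 : 0 < η) (hηM : η < M) (hr : 0 < r) (hd : eluderDim G η₀ = d)
    (hwM : ∀ k < n, w k ≤ M)
    (hw : ∀ k < n, ∀ v < w k, ∃ g ∈ G, ∃ h ∈ G,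
      ∑ j ∈ Finset.range k, (g (z j) - h (z j)) ^ 2 ≤ r ^ 2 ∧ v < g (z k) - h (z k)) :
    ∑ k ∈ Finset.range n, w k ≤ n * η + 2 * r ^ 2 * d / η + 2 * M * d := by
  -- The least level reaching `M`: minimality keeps it below `2M`, and `η < M` covers `J = 0`.
  obtain ⟨J, hJ, hJ'⟩ : ∃ J : ℕ, M ≤ 2 ^ J * η ∧ 2 ^ J * η ≤ 2 * M := by
    have hex : ∃ J : ℕ, M ≤ 2 ^ J * η := by
      obtain ⟨J, hJ⟩ := pow_unbounded_of_one_lt (M / η) (by norm_num : (1 : ℝ) < 2)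
      exact ⟨J, ((div_lt_iff₀ hη0).1 hJ).le⟩
    classical
    refine ⟨Nat.find hex, Nat.find_spec hex, ?_⟩
    rcases h : Nat.find hex with _ | k
    · simp only [pow_zero, one_mul]
      linarith
    · have := Nat.find_min hex (m := k) (by omega)
      rw [pow_succ]
      linarith
  have hN : ∀ j : ℕ, (((Finset.range n).filter fun k => 2 ^ j * η < w k).card : ℝ)
      ≤ (r ^ 2 / (2 ^ j * η) ^ 2 + 1) * d := by
    intro j
    refine card_width_gt_le G z _ (hη.trans ?_) (by positivity) hr hd fun k hk => ?_
    · exact le_mul_of_one_le_left hη0.le (one_le_pow₀ (by norm_num))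
    · obtain ⟨hk1, hk2⟩ := Finset.mem_filter.1 hk
      exact hw k (Finset.mem_range.1 hk1) _ hk2
  have hgeo : ∑ j ∈ Finset.range J, (2 : ℝ) ^ j = 2 ^ J - 1 := by
    rw [geom_sum_eq (by norm_num)]; norm_num
  have hgeo' : ∑ j ∈ Finset.range J, ((2 : ℝ) ^ j)⁻¹ ≤ 2 := by
    have : ∀ j : ℕ, ((2 : ℝ) ^ j)⁻¹ = (1 / 2) ^ j := by intro j; simp
    simp_rw [this]
    exact sum_geometric_two_le J
  calc ∑ k ∈ Finset.range n, w k
      ≤ ∑ k ∈ Finset.range n,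
        (η + ∑ j ∈ Finset.range J, if 2 ^ j * η < w k then 2 ^ j * η else 0) :=
        Finset.sum_le_sum fun k hk => le_add_sum_dyadic hη0 J
          ((hwM k (Finset.mem_range.1 hk)).trans hJ)
    _ = n * η + ∑ j ∈ Finset.range J,
        (((Finset.range n).filter fun k => 2 ^ j * η < w k).card : ℝ) * (2 ^ j * η) := by
        rw [Finset.sum_add_distrib, Finset.sum_comm]
        simp [Finset.sum_ite]
    _ ≤ n * η + ∑ j ∈ Finset.range J,
        (r ^ 2 / (2 ^ j * η) ^ 2 + 1) * d * (2 ^ j * η) := by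
        gcongr with j hj
        exact hN j
    -- The quadratic part of the count decays like `2⁻ʲ` and is summable; the constant part grows
    -- like `2ʲ` and is governed by the top level, of size at most `2M`.
    _ = n * η + (r ^ 2 * d / η * ∑ j ∈ Finset.range J, ((2 : ℝ) ^ j)⁻¹
        + η * d * ∑ j ∈ Finset.range J, (2 : ℝ) ^ j) := by
        rw [Finset.mul_sum, Finset.mul_sum, ← Finset.sum_add_distrib]
        congr 1
        refine Finset.sum_congr rfl fun j _ => ?_
        field_simp
    _ ≤ n * η + (r ^ 2 * d / η * 2 + d * (2 * M)) := by
        rw [hgeo]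
        have h1 : η * d * (2 ^ J - 1) ≤ d * (2 * M) := by
          have : (d : ℝ) * (2 ^ J * η) ≤ d * (2 * M) := by gcongr
          have : 0 ≤ η * d := by positivity
          linarith
        have h2 : r ^ 2 * d / η * ∑ j ∈ Finset.range J, ((2 : ℝ) ^ j)⁻¹ ≤ r ^ 2 * d / η * 2 := by
          gcongr
        linarith
    _ = n * η + 2 * r ^ 2 * d / η + 2 * M * d := by ring

end Eluder

/-! ### Exponential supermartingales -/

section Concentration

/-- Markov's inequality for the exponential of a random variable. -/
lemma measure_ge_le_of_lintegral_exp_le_one {Ω : Type*} [MeasurableSpace Ω] {μ : Measure Ω} {S : Ω → ℝ} (hS : AEMeasurable S μ)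
    (h : ∫⁻ ω, ENNReal.ofReal (Real.exp (S ω)) ∂μ ≤ 1) (a : ℝ) :
    μ {ω | a ≤ S ω} ≤ ENNReal.ofReal (Real.exp (-a)) := by
  have hM := mul_meas_ge_le_lintegral₀ (μ := μ)
    (f := fun ω => ENNReal.ofReal (Real.exp (S ω))) hS.exp.ennreal_ofReal
    (ENNReal.ofReal (Real.exp a))
  have hset : {ω | a ≤ S ω} ⊆
      {ω | ENNReal.ofReal (Real.exp a) ≤ ENNReal.ofReal (Real.exp (S ω))} := fun ω hω =>
    ENNReal.ofReal_le_ofReal (Real.exp_le_exp.2 hω)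
  have h1 : ENNReal.ofReal (Real.exp a) * μ {ω | a ≤ S ω} ≤ 1 :=
    (mul_le_mul_right (measure_mono hset) _).trans (hM.trans h)
  rw [Real.exp_neg, ENNReal.ofReal_inv_of_pos (Real.exp_pos a)]
  rw [mul_comm] at h1
  exact ENNReal.le_inv_iff_mul_le.2 h1

/-- If `W` and `H` are functions of the past and `e` is independent of the past, then multiplying
`W` by a nonnegative function of `(H, e)` with conditional mean at most one does not increase the
integral. -/
lemma lintegral_mul_le_of_indep {Ω E 𝓗 : Type*} {m₀ : MeasurableSpace Ω} [mΩ : MeasurableSpace Ω]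
    [MeasurableSpace E] [MeasurableSpace 𝓗] {μ : Measure Ω} [IsProbabilityMeasure μ] {Q : Measure E}
    (hm : m₀ ≤ mΩ) {W : Ω → ℝ≥0∞} {H : Ω → 𝓗} {e : Ω → E} (hW : Measurable[m₀] W)
    (hH : Measurable[m₀] H) (he : Measurable e)
    (hind : Indep m₀ (MeasurableSpace.comap e inferInstance) μ) (hlaw : μ.map e = Q)
    {φ : 𝓗 × E → ℝ≥0∞} (hφ : Measurable φ) (hφ1 : ∀ h, ∫⁻ y, φ (h, y) ∂Q ≤ 1) :
    ∫⁻ ω, W ω * φ (H ω, e ω) ∂μ ≤ ∫⁻ ω, W ω ∂μ := by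
  have hWH : Measurable[m₀] fun ω => (W ω, H ω) := hW.prodMk hH
  have hWH' : Measurable fun ω => (W ω, H ω) := hWH.mono hm le_rfl
  have hindep : IndepFun (fun ω => (W ω, H ω)) e μ :=
    indep_of_indep_of_le_left hind hWH.comap_le
  have hmap := (indepFun_iff_map_prod_eq_prod_map_map hWH'.aemeasurable he.aemeasurable).1 hindep
  rw [hlaw] at hmap
  have hQ : IsProbabilityMeasure Q := hlaw ▸ Measure.isProbabilityMeasure_map he.aemeasurable
  have hg : Measurable fun p : (ℝ≥0∞ × 𝓗) × E => p.1.1 * φ (p.1.2, p.2) := by fun_prop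
  -- The joint law of `(W, H)` and `e` is a product, so `e` can be integrated out first with the
  -- past frozen.
  calc ∫⁻ ω, W ω * φ (H ω, e ω) ∂μ
      = ∫⁻ p, p.1.1 * φ (p.1.2, p.2) ∂(μ.map fun ω => ((W ω, H ω), e ω)) :=
        (lintegral_map hg (hWH'.prodMk he)).symm
    _ = ∫⁻ q, ∫⁻ y, q.1 * φ (q.2, y) ∂Q ∂(μ.map fun ω => (W ω, H ω)) := by
        rw [hmap, lintegral_prod _ hg.aemeasurable]
    _ ≤ ∫⁻ q, q.1 ∂(μ.map fun ω => (W ω, H ω)) := by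
        refine lintegral_mono fun q => ?_
        rw [lintegral_const_mul _ (by fun_prop)]
        exact (mul_le_mul_right (hφ1 q.2) _).trans (mul_one _).le
    _ = ∫⁻ ω, W ω ∂μ := lintegral_map measurable_fst hWH'

/-- The exponential supermartingale driven by innovations that are independent of the past. -/
lemma lintegral_exp_sum_le_one {Ω E : Type*} [mΩ : MeasurableSpace Ω] [MeasurableSpace E] {𝓗 : ℕ → Type*}
    [∀ i, MeasurableSpace (𝓗 i)] {μ : Measure Ω} [IsProbabilityMeasure μ] {Q : Measure E} {T : ℕ}
    (m : ℕ → MeasurableSpace Ω) (hmono : Monotone m) (hm : ∀ i ≤ T, m i ≤ mΩ)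
    (H : ∀ i, Ω → 𝓗 i) (e : ℕ → Ω → E) (ψ : ∀ i, 𝓗 i × E → ℝ)
    (hH : ∀ i < T, Measurable[m i] (H i)) (he : ∀ i < T, Measurable[m (i + 1)] (e i))
    (hind : ∀ i < T, Indep (m i) (MeasurableSpace.comap (e i) inferInstance) μ)
    (hlaw : ∀ i < T, μ.map (e i) = Q) (hψ : ∀ i < T, Measurable (ψ i))
    (hψ1 : ∀ i < T, ∀ h, ∫⁻ y, ENNReal.ofReal (Real.exp (ψ i (h, y))) ∂Q ≤ 1)
    {n : ℕ} (hn : n ≤ T) :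
    (Measurable[m n] fun ω => ∑ i ∈ Finset.range n, ψ i (H i ω, e i ω)) ∧
      ∫⁻ ω, ENNReal.ofReal (Real.exp (∑ i ∈ Finset.range n, ψ i (H i ω, e i ω))) ∂μ ≤ 1 := by
  have hmeas : ∀ n ≤ T, Measurable[m n] fun ω => ∑ i ∈ Finset.range n, ψ i (H i ω, e i ω) := by
    intro n hn
    refine Finset.measurable_sum _ fun i hi => ?_
    have hi' : i < n := Finset.mem_range.1 hi
    exact (hψ i (by omega)).comp (((hH i (by omega)).mono (hmono hi'.le) le_rfl).prodMk
      ((he i (by omega)).mono (hmono hi') le_rfl))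
  refine ⟨hmeas n hn, ?_⟩
  induction n with
  | zero => simp
  | succ n ih =>
    have hnT : n < T := hn
    refine le_trans (le_of_eq ?_) ((lintegral_mul_le_of_indep (μ := μ) (hm n hnT.le)
      (W := fun ω => ENNReal.ofReal (Real.exp (∑ i ∈ Finset.range n, ψ i (H i ω, e i ω))))
      (Real.measurable_exp.comp (hmeas n hnT.le)).ennreal_ofReal
      (hH n hnT) ((he n hnT).mono (hm _ hn) le_rfl) (hind n hnT) (hlaw n hnT)
      (φ := fun p => ENNReal.ofReal (Real.exp (ψ n p)))
      (Real.measurable_exp.comp (hψ n hnT)).ennreal_ofReal (hψ1 n hnT)).trans (ih hnT.le))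
    refine lintegral_congr fun ω => ?_
    rw [Finset.sum_range_succ, Real.exp_add, ENNReal.ofReal_mul (Real.exp_pos _).le]

/-- An affine majorant of the exponential survives integration, and `1 + u ≤ exp u` turns it back
into an exponential of the mean. -/
lemma lintegral_exp_mul_le {X : Type*} [MeasurableSpace X] {P : Measure X} [IsProbabilityMeasure P]
    {Y : X → ℝ} (hY : Integrable Y P) {a c : ℝ}
    (h : ∀ x, Real.exp (a * Y x) ≤ 1 + c * Y x) :
    ∫⁻ x, ENNReal.ofReal (Real.exp (a * Y x)) ∂P ≤ ENNReal.ofReal (Real.exp (c * ∫ x, Y x ∂P)) := by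
  have hint : Integrable (fun x => 1 + c * Y x) P := (integrable_const 1).add (hY.const_mul c)
  calc ∫⁻ x, ENNReal.ofReal (Real.exp (a * Y x)) ∂P
      ≤ ∫⁻ x, ENNReal.ofReal (1 + c * Y x) ∂P :=
        lintegral_mono fun x => ENNReal.ofReal_le_ofReal (h x)
    _ = ENNReal.ofReal (∫ x, (1 + c * Y x) ∂P) :=
        (ofReal_integral_eq_lintegral_ofReal hint
          (ae_of_all _ fun x => (Real.exp_pos _).le.trans (h x))).symm
    _ ≤ ENNReal.ofReal (Real.exp (c * ∫ x, Y x ∂P)) := by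
        refine ENNReal.ofReal_le_ofReal ?_
        rw [integral_add (integrable_const 1) (hY.const_mul c), integral_const_mul]
        simpa [add_comm] using Real.add_one_le_exp (c * ∫ x, Y x ∂P)

lemma integrable_of_mem_Icc {X : Type*} [MeasurableSpace X] {P : Measure X} [IsFiniteMeasure P]
    {Y : X → ℝ} (hY : Measurable Y) {M : ℝ} (h0 : ∀ x, 0 ≤ Y x) (hM : ∀ x, Y x ≤ M) :
    Integrable Y P :=
  Integrable.of_bound hY.aestronglyMeasurable M
    (ae_of_all _ fun x => by rw [Real.norm_eq_abs, abs_of_nonneg (h0 x)]; exact hM x)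

lemma exp_le_one_add_add_sq {u : ℝ} (hu : |u| ≤ 1) : Real.exp u ≤ 1 + u + u ^ 2 := by
  have := (abs_le.1 (Real.abs_exp_sub_one_sub_id_le hu)).2
  linarith

/-- Comparison of a bounded nonnegative variable with an independent copy. -/
lemma lintegral_exp_sub_copy_le_one {X : Type*} [MeasurableSpace X] {P : Measure X}
    [IsProbabilityMeasure P] {Y : X → ℝ} (hY : Measurable Y) {M : ℝ} (hMpos : 0 < M)
    (h0 : ∀ x, 0 ≤ Y x) (hM : ∀ x, Y x ≤ M) :
    ∫⁻ p : X × X, ENNReal.ofReal (Real.exp ((Y p.1 - 2 * Y p.2) / (8 * M))) ∂(P.prod P) ≤ 1 := by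
  have hint : Integrable Y P := integrable_of_mem_Icc hY h0 hM
  have hI : 0 ≤ ∫ x, Y x ∂P := integral_nonneg h0
  have hy : ∀ x, Y x / M ∈ Set.Icc (0 : ℝ) 1 := fun x =>
    ⟨div_nonneg (h0 x) hMpos.le, (div_le_one hMpos).2 (hM x)⟩
  -- With `y = Y/M ∈ [0,1]` and `y² ≤ y`: `exp(y/8) ≤ 1 + 9y/64` and `exp(-y/4) ≤ 1 - 3y/16`. Since
  -- `9/64 < 12/64`, the product of the two means is at most one; this is where the factor 2 is
  -- spent.
  have h1 := lintegral_exp_mul_le hint (a := 1 / (8 * M)) (c := 9 / 64 / M) fun x => by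
    obtain ⟨hy0, hy1⟩ := hy x
    have e1 : 1 / (8 * M) * Y x = Y x / M / 8 := by field_simp
    have e2 : 9 / 64 / M * Y x = 9 / 64 * (Y x / M) := by field_simp
    rw [e1, e2]
    have := exp_le_one_add_add_sq (u := Y x / M / 8) (by rw [abs_le]; constructor <;> linarith)
    nlinarith
  have h2 := lintegral_exp_mul_le hint (a := -(1 / (4 * M))) (c := -(3 / 16 / M)) fun x => by
    obtain ⟨hy0, hy1⟩ := hy x
    have e1 : -(1 / (4 * M)) * Y x = -(Y x / M / 4) := by field_simp
    have e2 : -(3 / 16 / M) * Y x = -(3 / 16 * (Y x / M)) := by field_simp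
    rw [e1, e2]
    have := exp_le_one_add_add_sq (u := -(Y x / M / 4)) (by rw [abs_le]; constructor <;> linarith)
    nlinarith
  calc ∫⁻ p : X × X, ENNReal.ofReal (Real.exp ((Y p.1 - 2 * Y p.2) / (8 * M))) ∂(P.prod P)
      = ∫⁻ p : X × X, ENNReal.ofReal (Real.exp (1 / (8 * M) * Y p.1)) *
          ENNReal.ofReal (Real.exp (-(1 / (4 * M)) * Y p.2)) ∂(P.prod P) := by
        refine lintegral_congr fun p => ?_
        rw [← ENNReal.ofReal_mul (Real.exp_pos _).le, ← Real.exp_add]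
        congr 2
        field_simp
        ring
    _ = (∫⁻ x, ENNReal.ofReal (Real.exp (1 / (8 * M) * Y x)) ∂P) *
          ∫⁻ x, ENNReal.ofReal (Real.exp (-(1 / (4 * M)) * Y x)) ∂P :=
        lintegral_prod_mul (f := fun x => ENNReal.ofReal (Real.exp (1 / (8 * M) * Y x)))
          (g := fun x => ENNReal.ofReal (Real.exp (-(1 / (4 * M)) * Y x)))
          (by fun_prop) (by fun_prop)
    _ ≤ ENNReal.ofReal (Real.exp (9 / 64 / M * ∫ x, Y x ∂P)) *
          ENNReal.ofReal (Real.exp (-(3 / 16 / M) * ∫ x, Y x ∂P)) := by gcongr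
    _ ≤ 1 := by
        rw [← ENNReal.ofReal_mul (Real.exp_pos _).le, ← Real.exp_add, ← ENNReal.ofReal_one]
        refine ENNReal.ofReal_le_ofReal (Real.exp_le_one_iff.2 ?_)
        have : 0 ≤ (∫ x, Y x ∂P) / M := by positivity
        have e : 9 / 64 / M * ∫ x, Y x ∂P + -(3 / 16 / M) * ∫ x, Y x ∂P
            = -(3 / 64) * ((∫ x, Y x ∂P) / M) := by ring
        linarith

/-- Comparison of the mean of a bounded nonnegative variable with the variable. -/
lemma lintegral_exp_mean_sub_le_one {X : Type*} [MeasurableSpace X] {P : Measure X}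
    [IsProbabilityMeasure P] {Y : X → ℝ} (hY : Measurable Y) {M : ℝ} (hMpos : 0 < M)
    (h0 : ∀ x, 0 ≤ Y x) (hM : ∀ x, Y x ≤ M) :
    ∫⁻ x, ENNReal.ofReal (Real.exp ((∫ y, Y y ∂P - 2 * Y x) / (4 * M))) ∂P ≤ 1 := by
  have hint : Integrable Y P := integrable_of_mem_Icc hY h0 hM
  -- Here `exp(-y/2) ≤ 1 - y/2 + y²/4 ≤ 1 - y/4`, which cancels the mean exactly.
  have h2 := lintegral_exp_mul_le hint (a := -(1 / (2 * M))) (c := -(1 / 4 / M)) fun x => by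
    have hy0 : 0 ≤ Y x / M := div_nonneg (h0 x) hMpos.le
    have hy1 : Y x / M ≤ 1 := (div_le_one hMpos).2 (hM x)
    have e1 : -(1 / (2 * M)) * Y x = -(Y x / M / 2) := by field_simp
    have e2 : -(1 / 4 / M) * Y x = -(1 / 4 * (Y x / M)) := by field_simp
    rw [e1, e2]
    have := exp_le_one_add_add_sq (u := -(Y x / M / 2)) (by rw [abs_le]; constructor <;> linarith)
    nlinarith
  calc ∫⁻ x, ENNReal.ofReal (Real.exp ((∫ y, Y y ∂P - 2 * Y x) / (4 * M))) ∂P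
      = ∫⁻ x, ENNReal.ofReal (Real.exp (1 / 4 / M * ∫ y, Y y ∂P)) *
          ENNReal.ofReal (Real.exp (-(1 / (2 * M)) * Y x)) ∂P := by
        refine lintegral_congr fun x => ?_
        rw [← ENNReal.ofReal_mul (Real.exp_pos _).le, ← Real.exp_add]
        congr 2
        field_simp
        ring
    _ ≤ ENNReal.ofReal (Real.exp (1 / 4 / M * ∫ y, Y y ∂P)) *
          ENNReal.ofReal (Real.exp (-(1 / 4 / M) * ∫ y, Y y ∂P)) := by
        rw [lintegral_const_mul _ (by fun_prop)]
        gcongr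
    _ = 1 := by
        rw [← ENNReal.ofReal_mul (Real.exp_pos _).le, ← Real.exp_add, ← ENNReal.ofReal_one]
        congr 1
        rw [Real.exp_eq_one_iff]
        ring

lemma abs_sinh_le_exp_half_sq (u : ℝ) : |Real.sinh u| ≤ Real.exp (u ^ 2 / 2) := by
  rw [Real.abs_sinh, ← sq_abs u]
  exact (Real.sinh_lt_cosh _).le.trans (Real.cosh_le_exp_half_sq _)

/-- One step of the exponential supermartingale of bounded, conditionally centred noise. -/
lemma integral_mul_exp_noise_le {Ω : Type*} {m₀ : MeasurableSpace Ω} [mΩ : MeasurableSpace Ω]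
    {μ : Measure Ω} [IsProbabilityMeasure μ] (hm : m₀ ≤ mΩ) {N U ξ : Ω → ℝ} {b C : ℝ} (hb : 0 < b) (hN : Measurable[m₀] N)
    (hU : Measurable[m₀] U) (hξ : Measurable ξ) (hN0 : ∀ ω, 0 ≤ N ω)
    (hNC : ∀ᵐ ω ∂μ, N ω ≤ C) (hξb : ∀ᵐ ω ∂μ, |ξ ω| ≤ b) (hmean : μ[ξ | m₀] =ᵐ[μ] 0) :
    ∫ ω, N ω * Real.exp (U ω * ξ ω - (U ω * b) ^ 2 / 2) ∂μ ≤ ∫ ω, N ω ∂μ := by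
  -- Convexity puts `exp(Uξ)` below its chord on `|ξ| ≤ b`, namely `cosh(Ub) + (ξ/b) sinh(Ub)`.
  -- After division by `exp((Ub)²/2)` this is at most `1 + Gξ`. As `G` is bounded by `1/b`, no bound
  -- on `U` is needed.
  let G : Ω → ℝ := fun ω => Real.sinh (U ω * b) / b * Real.exp (-((U ω * b) ^ 2 / 2))
  have hGm : Measurable[m₀] G :=
    ((Real.measurable_sinh.comp (hU.mul_const b)).div_const b).mul
      (Real.measurable_exp.comp (((hU.mul_const b).pow_const 2).div_const 2).neg)
  have hGb : ∀ ω, |G ω| ≤ 1 / b := by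
    intro ω
    have h1 := abs_sinh_le_exp_half_sq (U ω * b)
    simp only [G]
    rw [abs_mul, abs_div, abs_of_pos hb, abs_of_pos (Real.exp_pos _), Real.exp_neg,
      ← div_eq_mul_inv, div_le_iff₀ (Real.exp_pos _), div_mul_eq_mul_div, one_mul]
    gcongr
  have hξint : Integrable ξ μ := Integrable.of_bound hξ.aestronglyMeasurable b (by simpa using hξb)
  have hNint : Integrable N μ := Integrable.of_bound (hN.mono hm le_rfl).aestronglyMeasurable C (by
    filter_upwards [hNC] with ω hω
    rwa [Real.norm_eq_abs, abs_of_nonneg (hN0 ω)])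
  have hNGb : ∀ᵐ ω ∂μ, ‖(N * G) ω‖ ≤ C * (1 / b) := by
    filter_upwards [hNC] with ω hω
    rw [Pi.mul_apply, norm_mul, Real.norm_eq_abs, Real.norm_eq_abs, abs_of_nonneg (hN0 ω)]
    exact mul_le_mul hω (hGb ω) (abs_nonneg _) ((hN0 ω).trans hω)
  have hNGm : Measurable[m₀] (N * G) := hN.mul hGm
  have hNGint : Integrable (N * G * ξ) μ :=
    hξint.bdd_mul (hNGm.mono hm le_rfl).aestronglyMeasurable hNGb
  have hzero : ∫ ω, (N * G * ξ) ω ∂μ = 0 := by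
    rw [← integral_condExp hm]
    have h1 := condExp_stronglyMeasurable_mul_of_bound hm hNGm.stronglyMeasurable hξint _ hNGb
    have h2 : μ[N * G * ξ | m₀] =ᵐ[μ] 0 := by
      filter_upwards [h1, hmean] with ω h h'
      rw [h, Pi.mul_apply, h']
      simp
    rw [integral_congr_ae h2]
    simp
  calc ∫ ω, N ω * Real.exp (U ω * ξ ω - (U ω * b) ^ 2 / 2) ∂μ
      ≤ ∫ ω, (N ω + (N * G * ξ) ω) ∂μ := by
        refine integral_mono_of_nonneg (ae_of_all _ fun ω => mul_nonneg (hN0 ω) (Real.exp_pos _).le)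
          (hNint.add hNGint) ?_
        filter_upwards [hξb] with ω hω
        have h1 := Real.exp_mul_le_cosh_add_mul_sinh (t := ξ ω / b)
          (by rwa [abs_div, abs_of_pos hb, div_le_one hb]) (U ω * b)
        have h2 := Real.cosh_le_exp_half_sq (U ω * b)
        have e1 : ξ ω / b * (U ω * b) = U ω * ξ ω := by field_simp
        rw [e1] at h1
        have h3 : Real.exp (U ω * ξ ω - (U ω * b) ^ 2 / 2) ≤ 1 + G ω * ξ ω := by
          rw [sub_eq_add_neg, Real.exp_add]
          calc Real.exp (U ω * ξ ω) * Real.exp (-((U ω * b) ^ 2 / 2))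
              ≤ (Real.exp ((U ω * b) ^ 2 / 2) + ξ ω / b * Real.sinh (U ω * b)) *
                Real.exp (-((U ω * b) ^ 2 / 2)) := by gcongr; linarith
            _ = 1 + G ω * ξ ω := by
                rw [add_mul, ← Real.exp_add, add_neg_cancel, Real.exp_zero]
                simp only [G]
                ring
        calc N ω * Real.exp (U ω * ξ ω - (U ω * b) ^ 2 / 2) ≤ N ω * (1 + G ω * ξ ω) :=
              mul_le_mul_of_nonneg_left h3 (hN0 ω)
          _ = N ω + (N * G * ξ) ω := by simp only [Pi.mul_apply]; ring
    _ = ∫ ω, N ω ∂μ := by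
        rw [integral_add hNint hNGint, hzero, add_zero]

/-- The exponential supermartingale of bounded, conditionally centred noise with predictable
weights. -/
lemma lintegral_exp_noise_le_one {Ω : Type*} [mΩ : MeasurableSpace Ω] {μ : Measure Ω}
    [IsProbabilityMeasure μ] {T : ℕ}
    (m : ℕ → MeasurableSpace Ω) (hmono : Monotone m) (hm : ∀ t < T, m t ≤ mΩ)
    {U ξ : ℕ → Ω → ℝ} {b : ℝ} (hb : 0 < b) (hU : ∀ t < T, Measurable[m t] (U t))
    (hξ : ∀ t < T, Measurable (ξ t)) (hξm : ∀ s t, s < t → t < T → Measurable[m t] (ξ s))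
    (hξb : ∀ t < T, ∀ᵐ ω ∂μ, |ξ t ω| ≤ b) (hmean : ∀ t < T, μ[ξ t | m t] =ᵐ[μ] 0)
    {n : ℕ} (hn : n ≤ T) :
    ∫⁻ ω, ENNReal.ofReal (Real.exp (∑ t ∈ Finset.range n,
      (U t ω * ξ t ω - (U t ω * b) ^ 2 / 2))) ∂μ ≤ 1 := by
  -- From `u - u²/2 ≤ 1/2` with `u = |U|b`; this makes the exponentials bounded, hence integrable,
  -- for unbounded weights.
  have hterm : ∀ t < T, ∀ᵐ ω ∂μ, U t ω * ξ t ω - (U t ω * b) ^ 2 / 2 ≤ 1 / 2 := by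
    intro t ht
    filter_upwards [hξb t ht] with ω hω
    have h1 : U t ω * ξ t ω ≤ |U t ω| * b :=
      (le_abs_self _).trans (by rw [abs_mul]; gcongr)
    have h2 : (U t ω * b) ^ 2 = (|U t ω| * b) ^ 2 := by rw [mul_pow, mul_pow, sq_abs]
    nlinarith [sq_nonneg (|U t ω| * b - 1)]
  have hbound : ∀ n ≤ T, ∀ᵐ ω ∂μ, Real.exp (∑ t ∈ Finset.range n,
      (U t ω * ξ t ω - (U t ω * b) ^ 2 / 2)) ≤ Real.exp (n * (1 / 2)) := by
    intro n hn
    have : ∀ᵐ ω ∂μ, ∀ t ∈ Finset.range n, U t ω * ξ t ω - (U t ω * b) ^ 2 / 2 ≤ 1 / 2 :=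
      (Finset.eventually_all _).2 fun t ht => hterm t (by have := Finset.mem_range.1 ht; omega)
    filter_upwards [this] with ω hω
    refine Real.exp_le_exp.2 ((Finset.sum_le_card_nsmul _ _ _ hω).trans (le_of_eq ?_))
    simp
  have hmeas : ∀ n < T, Measurable[m n] fun ω => Real.exp (∑ t ∈ Finset.range n,
      (U t ω * ξ t ω - (U t ω * b) ^ 2 / 2)) := by
    intro n hn
    refine Real.measurable_exp.comp (Finset.measurable_sum _ fun t ht => ?_)
    have htn := Finset.mem_range.1 ht
    have hUt : Measurable[m n] (U t) := (hU t (by omega)).mono (hmono htn.le) le_rfl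
    exact (hUt.mul (hξm t n htn hn)).sub (((hUt.mul_const b).pow_const 2).div_const 2)
  -- The case `n = T` needs measurability in the ambient σ-algebra, since nothing is assumed about
  -- `m T`.
  have hmeas' : ∀ n ≤ T, Measurable fun ω => Real.exp (∑ t ∈ Finset.range n,
      (U t ω * ξ t ω - (U t ω * b) ^ 2 / 2)) := by
    intro n hn
    refine Real.measurable_exp.comp (Finset.measurable_sum _ fun t ht => ?_)
    have htn := Finset.mem_range.1 ht
    have hUt : Measurable (U t) := (hU t (by omega)).mono (hm t (by omega)) le_rfl
    exact (hUt.mul (hξ t (by omega))).sub (((hUt.mul_const b).pow_const 2).div_const 2)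
  have hreal : ∀ n ≤ T, ∫ ω, Real.exp (∑ t ∈ Finset.range n,
      (U t ω * ξ t ω - (U t ω * b) ^ 2 / 2)) ∂μ ≤ 1 := by
    intro n
    induction n with
    | zero => simp
    | succ n ih =>
      intro hn
      have hnT : n < T := hn
      refine le_trans (le_of_eq ?_) ((integral_mul_exp_noise_le (hm n hnT) hb (hmeas n hnT)
        (hU n hnT) (hξ n hnT) (fun ω => (Real.exp_pos _).le) (hbound n hnT.le) (hξb n hnT)
        (hmean n hnT)).trans (ih hnT.le))
      refine integral_congr_ae (ae_of_all _ fun ω => ?_)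
      simp only
      rw [Finset.sum_range_succ, Real.exp_add]
  have hint : Integrable (fun ω => Real.exp (∑ t ∈ Finset.range n,
      (U t ω * ξ t ω - (U t ω * b) ^ 2 / 2))) μ :=
    Integrable.of_bound (hmeas' n hn).aestronglyMeasurable (Real.exp (n * (1 / 2))) (by
      filter_upwards [hbound n hn] with ω hω
      rwa [Real.norm_eq_abs, abs_of_pos (Real.exp_pos _)])
  rw [← ofReal_integral_eq_lintegral_ofReal hint (ae_of_all _ fun ω => (Real.exp_pos _).le),
    ← ENNReal.ofReal_one]
  exact ENNReal.ofReal_le_ofReal (hreal n hn)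

end Concentration

/-! ### Data of planner and sampler; measurability -/

section Interaction

variable {X A : Type*}

/-- The context-action pair that the planner visits in step `i`. -/
def planPoint (plan : (n : ℕ) → (Fin n → X × A) → X → A) (x : ℕ → X) (i : ℕ) : X × A :=
  (x i, explorationPolicy plan x i (x i))

/-- The context-action pair that the sampler visits in step `i`. -/
def samplePoint (plan : (n : ℕ) → (Fin n → X × A) → X → A) (x xs : ℕ → X) (i : ℕ) : X × A :=
  (xs i, explorationPolicy plan x i (xs i))

lemma planData_apply (plan : (n : ℕ) → (Fin n → X × A) → X → A) (x : ℕ → X) (n : ℕ) (i : Fin n) :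
    planData plan x n i = planPoint plan x i := by
  induction n with
  | zero => exact i.elim0
  | succ n ih =>
    refine Fin.lastCases ?_ (fun j => ?_) i
    · simp [planData, planPoint, explorationPolicy]
    · simp [planData, ih j]

lemma dataNorm_self {Z : Type*} {n : ℕ} (g : Z → ℝ) (D : Fin n → Z) : dataNorm g g D = 0 := by
  simp [dataNorm]

lemma dataNorm_le_iff {Z : Type*} {n : ℕ} (g h : Z → ℝ) (z : ℕ → Z) {r : ℝ} (hr : 0 ≤ r) :
    dataNorm g h (fun i : Fin n => z i) ≤ r ↔
      ∑ i ∈ Finset.range n, (g (z i) - h (z i)) ^ 2 ≤ r ^ 2 := by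
  rw [dataNorm, Real.sqrt_le_left hr, Finset.sum_range]

lemma planData_eq (plan : (n : ℕ) → (Fin n → X × A) → X → A) (x : ℕ → X) (n : ℕ) :
    planData plan x n = fun i : Fin n => planPoint plan x i :=
  funext (planData_apply plan x n)

section Uncertainty

variable {F : Finset (X × A → ℝ)} {r B : ℝ} {n : ℕ}

/-- Finiteness of `F` makes the supremum an attained maximum; for `r ≥ 0` the diagonal pairs keep
the set nonempty. -/
lemma uncertainty_set_finite (F : Finset (X × A → ℝ)) (r : ℝ) (D : Fin n → X × A) (z : X × A) :
    {v : ℝ | ∃ f ∈ F, ∃ f' ∈ F, dataNorm f f' D ≤ r ∧ v = f z - f' z}.Finite := by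
  refine ((F ×ˢ F).finite_toSet.image fun p => p.1 z - p.2 z).subset ?_
  rintro v ⟨f, hf, f', hf', -, rfl⟩
  exact ⟨(f, f'), by simp [hf, hf'], rfl⟩

lemma le_uncertainty {f f' : X × A → ℝ} (hf : f ∈ F) (hf' : f' ∈ F) {D : Fin n → X × A}
    (h : dataNorm f f' D ≤ r) (z : X × A) : f z - f' z ≤ uncertainty F r D z :=
  le_csSup (uncertainty_set_finite F r D z).bddAbove ⟨f, hf, f', hf', h, rfl⟩

lemma uncertainty_mem (hF : F.Nonempty) (hr : 0 ≤ r) (D : Fin n → X × A) (z : X × A) :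
    ∃ f ∈ F, ∃ f' ∈ F, dataNorm f f' D ≤ r ∧ uncertainty F r D z = f z - f' z := by
  obtain ⟨f, hf⟩ := hF
  exact Set.Nonempty.csSup_mem (s := {v : ℝ | ∃ f ∈ F, ∃ f' ∈ F, dataNorm f f' D ≤ r ∧
    v = f z - f' z}) ⟨_, f, hf, f, hf, (dataNorm_self f D).trans_le hr, rfl⟩
    (uncertainty_set_finite F r D z)

lemma uncertainty_nonneg (hF : F.Nonempty) (hr : 0 ≤ r) (D : Fin n → X × A) (z : X × A) :
    0 ≤ uncertainty F r D z := by
  obtain ⟨f, hf⟩ := hF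
  simpa using le_uncertainty hf hf ((dataNorm_self f D).trans_le hr) z

lemma uncertainty_le (hF : F.Nonempty) (hr : 0 ≤ r) (hB : ∀ f ∈ F, ∀ z, |f z| ≤ B)
    (D : Fin n → X × A) (z : X × A) : uncertainty F r D z ≤ 2 * B := by
  obtain ⟨f, hf, f', hf', -, h⟩ := uncertainty_mem hF hr D z
  have h1 := abs_le.1 (hB f hf z)
  have h2 := abs_le.1 (hB f' hf' z)
  linarith

/-- Used for joint measurability in data and point: the index set of the maximum no longer depends
on the data. The default value 0 is harmless because diagonal pairs already attain it. -/
lemma uncertainty_eq_sup' (hF : F.Nonempty) (hr : 0 ≤ r) (D : Fin n → X × A) (z : X × A) :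
    uncertainty F r D z = (F ×ˢ F).sup' (hF.product hF)
      (fun p => if dataNorm p.1 p.2 D ≤ r then p.1 z - p.2 z else 0) := by
  apply le_antisymm
  · obtain ⟨f, hf, f', hf', hd, h⟩ := uncertainty_mem hF hr D z
    refine (le_of_eq ?_).trans (Finset.le_sup'
      (fun p : (X × A → ℝ) × (X × A → ℝ) =>
        if dataNorm p.1 p.2 D ≤ r then p.1 z - p.2 z else 0) (Finset.mk_mem_product hf hf'))
    simp [hd, h]
  · refine Finset.sup'_le _ _ fun p hp => ?_
    obtain ⟨h1, h2⟩ := Finset.mem_product.1 hp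
    split_ifs with hd
    · exact le_uncertainty h1 h2 hd z
    · exact uncertainty_nonneg hF hr D z

variable [MeasurableSpace X] [MeasurableSpace A]

lemma measurable_dataNorm {f f' : X × A → ℝ} (hf : Measurable f) (hf' : Measurable f') :
    Measurable fun D : Fin n → X × A => dataNorm f f' D := by
  unfold dataNorm
  fun_prop

lemma measurable_uncertainty (hF : F.Nonempty) (hFm : ∀ f ∈ F, Measurable f) (hr : 0 ≤ r) :
    Measurable fun p : (Fin n → X × A) × (X × A) => uncertainty F r p.1 p.2 := by
  simp_rw [uncertainty_eq_sup' hF hr]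
  have key := Finset.measurable_sup' (hF.product hF)
    (f := fun (q : (X × A → ℝ) × (X × A → ℝ)) (p : (Fin n → X × A) × (X × A)) =>
      if dataNorm q.1 q.2 p.1 ≤ r then q.1 p.2 - q.2 p.2 else 0) fun q hq => by
    obtain ⟨h1, h2⟩ := Finset.mem_product.1 hq
    refine Measurable.ite ?_ ?_ measurable_const
    · exact measurableSet_le ((measurable_dataNorm (hFm _ h1) (hFm _ h2)).comp measurable_fst)
        measurable_const
    · exact ((hFm _ h1).comp measurable_snd).sub ((hFm _ h2).comp measurable_snd)
  convert key using 1
  ext p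
  rw [Finset.sup'_apply]

end Uncertainty

lemma optimisticValue_set_finite (F : Finset (X × A → ℝ)) (fhat : X × A → ℝ) (r : ℝ) {n : ℕ}
    (D : Fin n → X × A) (z : X × A) :
    {v : ℝ | ∃ f ∈ F, dataNorm fhat f D ≤ r ∧ v = f z}.Finite := by
  refine (F.finite_toSet.image fun f => f z).subset ?_
  rintro v ⟨f, hf, -, rfl⟩
  exact ⟨f, hf, rfl⟩

variable [MeasurableSpace X] [MeasurableSpace A] {T : ℕ}
  {plan : (n : ℕ) → (Fin n → X × A) → X → A}

/-- The σ-algebra on `Ω` is left arbitrary, so that instances with `contextPast` or `history`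
express predictability. -/
lemma measurable_planData {Ω : Type*} [MeasurableSpace Ω]
    (hplan : ∀ n < T, Measurable fun p : (Fin n → X × A) × X => plan n p.1 p.2)
    {x : ℕ → Ω → X} {n : ℕ} (hn : n ≤ T) (hx : ∀ i < n, Measurable (x i)) :
    Measurable fun ω => planData plan (fun i => x i ω) n := by
  induction n with
  | zero => exact measurable_pi_iff.2 fun i => i.elim0
  | succ n ih =>
    have hD := ih (by omega) fun i hi => hx i (by omega)
    refine measurable_pi_iff.2 fun i => ?_
    refine Fin.lastCases ?_ (fun j => ?_) i
    · simp only [planData, Fin.snoc_last]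
      exact (hx n (by omega)).prodMk ((hplan n hn).comp (hD.prodMk (hx n (by omega))))
    · simp only [planData, Fin.snoc_castSucc]
      exact (measurable_pi_apply j).comp hD

lemma measurable_explorationPolicy {Ω : Type*} [MeasurableSpace Ω]
    (hplan : ∀ n < T, Measurable fun p : (Fin n → X × A) × X => plan n p.1 p.2)
    {x : ℕ → Ω → X} {y : Ω → X} {n : ℕ} (hn : n < T) (hx : ∀ i < n, Measurable (x i))
    (hy : Measurable y) :
    Measurable fun ω => explorationPolicy plan (fun i => x i ω) n (y ω) :=
  (hplan n hn).comp ((measurable_planData hplan hn.le hx).prodMk hy)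

/-! ### Concentration in the stochastic environment -/

section Environment

variable {Ω : Type*}

/-- The information contained in the first `n` planning and sampling contexts. -/
abbrev contextPast (x xs : ℕ → Ω → X) (n : ℕ) : MeasurableSpace Ω :=
  ⨆ (i : ℕ) (_ : i < n), MeasurableSpace.comap (x i) inferInstance ⊔
    MeasurableSpace.comap (xs i) inferInstance

lemma contextPast_mono (x xs : ℕ → Ω → X) : Monotone (contextPast x xs) := fun _ _ h =>
  iSup₂_le fun i hi => le_iSup₂_of_le i (hi.trans_le h) le_rfl

lemma measurable_contextPast_fst (x xs : ℕ → Ω → X) {i n : ℕ} (h : i < n) :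
    Measurable[contextPast x xs n] (x i) :=
  measurable_iff_comap_le.2 (le_iSup₂_of_le i h le_sup_left)

lemma measurable_contextPast_snd (x xs : ℕ → Ω → X) {i n : ℕ} (h : i < n) :
    Measurable[contextPast x xs n] (xs i) :=
  measurable_iff_comap_le.2 (le_iSup₂_of_le i h le_sup_right)

lemma history_mono (m : ℕ) (x xs : ℕ → Ω → X) (ξ : ℕ → Ω → ℝ) :
    Monotone (history m x xs ξ) := fun _ _ h =>
  sup_le_sup (sup_le_sup le_rfl (biSup_mono fun _ hs => hs.trans h))
    (biSup_mono fun _ hs => hs.trans_le h)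

variable [mΩ : MeasurableSpace Ω] {μ : Measure Ω} {P : Measure X} {Bbar : ℝ} {m : ℕ}
  {x xs : ℕ → Ω → X} {ξ : ℕ → Ω → ℝ}

lemma IsEnvironment.contextPast_le (henv : IsEnvironment μ P Bbar m T x xs ξ) (hTm : T ≤ m) {n : ℕ}
    (hn : n ≤ T) : contextPast x xs n ≤ mΩ :=
  iSup₂_le fun i hi => sup_le (henv.measurable_offline i (by omega)).comap_le
    (henv.measurable_sampling i (by omega)).comap_le

lemma IsEnvironment.measurable_sum_elim (henv : IsEnvironment μ P Bbar m T x xs ξ)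
    (j : Fin m ⊕ Fin T) :
    Measurable (Sum.elim (fun i : Fin m => x i) (fun t : Fin T => xs t) j) := by
  rcases j with i | t
  · exact henv.measurable_offline i i.2
  · exact henv.measurable_sampling t t.2

lemma IsEnvironment.history_le (henv : IsEnvironment μ P Bbar m T x xs ξ) {t : ℕ} (ht : t < T) :
    history m x xs ξ t ≤ mΩ :=
  sup_le (sup_le (iSup₂_le fun i hi => (henv.measurable_offline i hi).comap_le)
    (iSup₂_le fun s hs => (henv.measurable_sampling s (by omega)).comap_le))
    (iSup₂_le fun s hs => (henv.measurable_noise s (by omega)).comap_le)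

/-- The past and the pair of step `n` use disjoint index sets of one independent family; `T ≤ m`
supplies an offline context for every sampling step. -/
lemma IsEnvironment.indep_contextPast (henv : IsEnvironment μ P Bbar m T x xs ξ) (hTm : T ≤ m)
    {n : ℕ} (hn : n < T) :
    Indep (contextPast x xs n)
      (MeasurableSpace.comap (fun ω => (x n ω, xs n ω)) inferInstance) μ := by
  let g : Fin m ⊕ Fin T → Ω → X := Sum.elim (fun i : Fin m => x i) (fun t : Fin T => xs t)
  let S : Set (Fin m ⊕ Fin T) := {j | Sum.elim (Fin.val : Fin m → ℕ) (Fin.val : Fin T → ℕ) j < n}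
  have hST : Disjoint S Sᶜ := disjoint_compl_right
  have key := indep_iSup_of_disjoint
    (m := fun j => MeasurableSpace.comap (g j) inferInstance)
    (fun j => (henv.measurable_sum_elim j).comap_le) henv.indep hST
  refine indep_of_indep_of_le_left (indep_of_indep_of_le_right key ?_) ?_
  · refine Measurable.comap_le (Measurable.prodMk ?_ ?_)
    · exact measurable_iff_comap_le.2 (le_iSup₂_of_le (f := fun j (_ : j ∈ Sᶜ) =>
        MeasurableSpace.comap (g j) inferInstance) (Sum.inl ⟨n, by omega⟩) (by simp [S]) le_rfl)
    · exact measurable_iff_comap_le.2 (le_iSup₂_of_le (f := fun j (_ : j ∈ Sᶜ) =>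
        MeasurableSpace.comap (g j) inferInstance) (Sum.inr ⟨n, hn⟩) (by simp [S]) le_rfl)
  · refine iSup₂_le fun i hi => sup_le ?_ ?_
    · exact le_iSup₂_of_le (f := fun j (_ : j ∈ S) =>
        MeasurableSpace.comap (g j) inferInstance) (Sum.inl ⟨i, by omega⟩) (by simpa [S]) le_rfl
    · exact le_iSup₂_of_le (f := fun j (_ : j ∈ S) =>
        MeasurableSpace.comap (g j) inferInstance) (Sum.inr ⟨i, by omega⟩) (by simpa [S]) le_rfl

variable [IsProbabilityMeasure μ]

lemma IsEnvironment.map_contexts (henv : IsEnvironment μ P Bbar m T x xs ξ) (hTm : T ≤ m)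
    {n : ℕ} (hn : n < T) : μ.map (fun ω => (x n ω, xs n ω)) = P.prod P := by
  have h := henv.indep.indepFun (i := Sum.inl ⟨n, by omega⟩) (j := Sum.inr ⟨n, hn⟩) (by simp)
  have hx := henv.measurable_offline n (by omega)
  have hxs := henv.measurable_sampling n hn
  have := (indepFun_iff_map_prod_eq_prod_map_map (μ := μ) hx.aemeasurable hxs.aemeasurable).1 h
  rw [this, henv.law_offline n (by omega), henv.law_sampling n hn]

/-- The data norm on the planning data is controlled by the data norm on the sampling data. -/
lemma IsEnvironment.measure_plan_sub_sample_ge_le [IsProbabilityMeasure P]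
    (henv : IsEnvironment μ P Bbar m T x xs ξ)
    (hTm : T ≤ m) (hplan : ∀ n < T, Measurable fun p : (Fin n → X × A) × X => plan n p.1 p.2)
    {Y : X × A → ℝ} (hY : Measurable Y) {M : ℝ} (hM : 0 < M) (hY0 : ∀ z, 0 ≤ Y z)
    (hYM : ∀ z, Y z ≤ M) {n : ℕ} (hn : n ≤ T) (a : ℝ) :
    μ {ω | a ≤ ∑ i ∈ Finset.range n, (Y (planPoint plan (fun i => x i ω) i) -
      2 * Y (samplePoint plan (fun i => x i ω) (fun i => xs i ω) i)) / (8 * M)} ≤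
      ENNReal.ofReal (Real.exp (-a)) := by
  have hYp : ∀ i < T, Measurable fun p : (Fin i → X × A) × X => Y (p.2, plan i p.1 p.2) :=
    fun i hi => hY.comp (measurable_snd.prodMk (hplan i hi))
  -- The innovation is the pair of contexts, with law `P ⊗ P`. With the planner's data frozen, both
  -- coordinates are fed to the same policy, so the comparison with an independent copy applies.
  have key := lintegral_exp_sum_le_one (μ := μ) (Q := P.prod P) (T := T) (contextPast x xs)
    (contextPast_mono x xs) (fun i hi => henv.contextPast_le hTm hi)
    (𝓗 := fun i => Fin i → X × A)
    (fun i ω => planData plan (fun i => x i ω) i) (fun i ω => (x i ω, xs i ω))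
    (fun i p => (Y (p.2.1, plan i p.1 p.2.1) - 2 * Y (p.2.2, plan i p.1 p.2.2)) / (8 * M))
    (fun i hi => @measurable_planData X A _ _ T plan Ω (contextPast x xs i) hplan x i hi.le
      fun j hj => measurable_contextPast_fst x xs hj)
    (fun i hi => Measurable.prodMk (measurable_contextPast_fst x xs i.lt_succ_self)
      (measurable_contextPast_snd x xs i.lt_succ_self))
    (fun i hi => henv.indep_contextPast hTm hi) (fun i hi => henv.map_contexts hTm hi)
    (fun i hi => by
      have h1 := (hYp i hi).comp (measurable_fst.prodMk (measurable_fst.comp measurable_snd) :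
        Measurable fun p : (Fin i → X × A) × (X × X) => (p.1, p.2.1))
      have h2 := (hYp i hi).comp (measurable_fst.prodMk (measurable_snd.comp measurable_snd) :
        Measurable fun p : (Fin i → X × A) × (X × X) => (p.1, p.2.2))
      exact (h1.sub (h2.const_mul 2)).div_const _)
    (fun i hi h => lintegral_exp_sub_copy_le_one (P := P) (Y := fun y => Y (y, plan i h y))
      ((hYp i hi).comp measurable_prodMk_left) hM (fun y => hY0 _) (fun y => hYM _)) hn
  exact measure_ge_le_of_lintegral_exp_le_one
    (key.1.mono (henv.contextPast_le hTm hn) le_rfl).aemeasurable key.2 a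

/-- The means of bounded functions of the next context are controlled by their values on the
planning contexts. -/
lemma IsEnvironment.measure_mean_sub_plan_ge_le [IsProbabilityMeasure P]
    (henv : IsEnvironment μ P Bbar m T x xs ξ)
    (hTm : T ≤ m) (hplan : ∀ n < T, Measurable fun p : (Fin n → X × A) × X => plan n p.1 p.2)
    {w : ∀ i : ℕ, (Fin i → X × A) × X → ℝ} (hw : ∀ i < T, Measurable (w i)) {M : ℝ} (hM : 0 < M)
    (hw0 : ∀ i p, 0 ≤ w i p) (hwM : ∀ i p, w i p ≤ M) {n : ℕ} (hn : n ≤ T) (a : ℝ) :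
    μ {ω | a ≤ ∑ i ∈ Finset.range n,
      (∫ y, w i (planData plan (fun i => x i ω) i, y) ∂P -
        2 * w i (planData plan (fun i => x i ω) i, x i ω)) / (4 * M)} ≤
      ENNReal.ofReal (Real.exp (-a)) := by
  have key := lintegral_exp_sum_le_one (μ := μ) (Q := P) (T := T) (contextPast x xs)
    (contextPast_mono x xs) (fun i hi => henv.contextPast_le hTm hi)
    (𝓗 := fun i => Fin i → X × A)
    (fun i ω => planData plan (fun i => x i ω) i) x
    (fun i p => (∫ y, w i (p.1, y) ∂P - 2 * w i p) / (4 * M))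
    (fun i hi => @measurable_planData X A _ _ T plan Ω (contextPast x xs i) hplan x i hi.le
      fun j hj => measurable_contextPast_fst x xs hj)
    (fun i hi => measurable_contextPast_fst x xs i.lt_succ_self)
    (fun i hi => indep_of_indep_of_le_right (henv.indep_contextPast hTm hi)
      (measurable_iff_comap_le.1 (measurable_fst.comp (comap_measurable _))))
    (fun i hi => henv.law_offline i (by omega))
    (fun i hi => by
      have h1 : Measurable fun D : Fin i → X × A => ∫ y, w i (D, y) ∂P :=
        ((hw i hi).stronglyMeasurable.integral_prod_right' (ν := P)).measurable
      exact ((h1.comp measurable_fst).sub ((hw i hi).const_mul 2)).div_const _)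
    (fun i hi h => lintegral_exp_mean_sub_le_one (P := P) (Y := fun y => w i (h, y))
      ((hw i hi).comp measurable_prodMk_left) hM (fun y => hw0 _ _) (fun y => hwM _ _)) hn
  exact measure_ge_le_of_lintegral_exp_le_one
    (key.1.mono (henv.contextPast_le hTm hn) le_rfl).aemeasurable key.2 a

/-- Concentration of the noise weighted by a function of the sampled pairs. -/
lemma IsEnvironment.measure_noise_ge_le (henv : IsEnvironment μ P Bbar m T x xs ξ)
    (hBbar : 0 < Bbar)
    (hTm : T ≤ m) (hplan : ∀ n < T, Measurable fun p : (Fin n → X × A) × X => plan n p.1 p.2)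
    {g : X × A → ℝ} (hg : Measurable g) {n : ℕ} (hn : n ≤ T) (a : ℝ) :
    μ {ω | a ≤ ∑ i ∈ Finset.range n,
      (g (samplePoint plan (fun i => x i ω) (fun i => xs i ω) i) * ξ i ω / (2 * Bbar ^ 2) -
        g (samplePoint plan (fun i => x i ω) (fun i => xs i ω) i) ^ 2 / (8 * Bbar ^ 2))} ≤
      ENNReal.ofReal (Real.exp (-a)) := by
  -- The weight `g/(2 Bbar²)` gives the compensator `g²/(8 Bbar²)`, small enough for the basic
  -- inequality of least squares to leave a positive multiple of `∑ g²`. It is predictable because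
  -- `history` at `t` contains the sampling context of step `t`.
  have hU : ∀ t < T, Measurable[history m x xs ξ t] fun ω =>
      g (samplePoint plan (fun i => x i ω) (fun i => xs i ω) t) / (2 * Bbar ^ 2) := by
    intro t ht
    have hxs : Measurable[history m x xs ξ t] (xs t) := measurable_iff_comap_le.2
      (le_sup_of_le_left (le_sup_of_le_right (le_iSup₂_of_le t le_rfl le_rfl)))
    have hx : ∀ i < t, Measurable[history m x xs ξ t] (x i) := fun i hi =>
      measurable_iff_comap_le.2
        (le_sup_of_le_left (le_sup_of_le_left (le_iSup₂_of_le i (by omega) le_rfl)))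
    have hpol := @measurable_explorationPolicy X A _ _ T plan Ω (history m x xs ξ t) hplan x (xs t)
      t ht hx hxs
    exact (hg.comp (hxs.prodMk hpol)).div_const _
  have key := lintegral_exp_noise_le_one (μ := μ) (history m x xs ξ) (history_mono m x xs ξ)
    (fun t ht => henv.history_le ht) hBbar hU henv.measurable_noise
    (fun s t hst _ => measurable_iff_comap_le.2
      (le_sup_of_le_right (le_iSup₂_of_le s hst le_rfl))) henv.noise_bounded henv.noise_mean hn
  have hset : ∀ ω, ∑ i ∈ Finset.range n,
      (g (samplePoint plan (fun i => x i ω) (fun i => xs i ω) i) * ξ i ω / (2 * Bbar ^ 2) -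
        g (samplePoint plan (fun i => x i ω) (fun i => xs i ω) i) ^ 2 / (8 * Bbar ^ 2)) =
      ∑ i ∈ Finset.range n,
      (g (samplePoint plan (fun i => x i ω) (fun i => xs i ω) i) / (2 * Bbar ^ 2) * ξ i ω -
        (g (samplePoint plan (fun i => x i ω) (fun i => xs i ω) i) / (2 * Bbar ^ 2) * Bbar) ^ 2
          / 2) := by
    intro ω
    refine Finset.sum_congr rfl fun i _ => ?_
    field_simp
    ring
  simp_rw [hset]
  refine measure_ge_le_of_lintegral_exp_le_one ?_ key a
  refine (Finset.measurable_sum _ fun i hi => ?_).aemeasurable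
  have hiT : i < T := (Finset.mem_range.1 hi).trans_le hn
  have hUi := (hU i hiT).mono (henv.history_le hiT) le_rfl
  exact (hUi.mul (henv.measurable_noise i hiT)).sub (((hUi.mul_const _).pow_const 2).div_const 2)

end Environment

end Interaction

/-! ### Least squares and optimism -/

section Regret

variable {X A : Type*} {F : Finset (X × A → ℝ)}
  {plan : (n : ℕ) → (Fin n → X × A) → X → A}
  {ls : (n : ℕ) → (Fin n → (X × A) × ℝ) → X × A → ℝ}
  {opt : (n : ℕ) → (Fin n → (X × A) × ℝ) → X → A}
  {fstar : X × A → ℝ} {x xs : ℕ → X} {ξ : ℕ → ℝ} {T : ℕ}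

/-- The basic inequality of least squares. -/
lemma IsLeastSquares.sum_sq_le (hls : IsLeastSquares F ls) (hf : fstar ∈ F) (n : ℕ) :
    ∑ i ∈ Finset.range n, (ls n (samplerData plan x fstar xs ξ n) (samplePoint plan x xs i) -
        fstar (samplePoint plan x xs i)) ^ 2 ≤
      2 * ∑ i ∈ Finset.range n, (ls n (samplerData plan x fstar xs ξ n)
        (samplePoint plan x xs i) - fstar (samplePoint plan x xs i)) * ξ i := by
  set fhat := ls n (samplerData plan x fstar xs ξ n) with hfhat
  have h := (hls n (samplerData plan x fstar xs ξ n)).2 fstar hf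
  rw [← hfhat] at h
  have h1 : ∀ i : Fin n, fhat (samplerData plan x fstar xs ξ n i).1 -
      (samplerData plan x fstar xs ξ n i).2 =
      (fhat (samplePoint plan x xs i) - fstar (samplePoint plan x xs i)) - ξ i := fun i => by
    simp only [samplerData, samplePoint]
    ring
  have h2 : ∀ i : Fin n, fstar (samplerData plan x fstar xs ξ n i).1 -
      (samplerData plan x fstar xs ξ n i).2 = - ξ i := fun i => by
    simp only [samplerData]
    ring
  simp_rw [h1, h2] at h
  rw [← Finset.sum_range fun i =>
      ((fhat (samplePoint plan x xs i) - fstar (samplePoint plan x xs i)) - ξ i) ^ 2,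
    ← Finset.sum_range fun i => (-ξ i) ^ 2] at h
  have h3 : ∑ i ∈ Finset.range n,
      ((fhat (samplePoint plan x xs i) - fstar (samplePoint plan x xs i)) - ξ i) ^ 2 =
      ∑ i ∈ Finset.range n, (fhat (samplePoint plan x xs i) - fstar (samplePoint plan x xs i)) ^ 2
      - 2 * ∑ i ∈ Finset.range n,
        (fhat (samplePoint plan x xs i) - fstar (samplePoint plan x xs i)) * ξ i
      + ∑ i ∈ Finset.range n, (-ξ i) ^ 2 := by
    rw [Finset.mul_sum, ← Finset.sum_sub_distrib, ← Finset.sum_add_distrib]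
    exact Finset.sum_congr rfl fun i _ => by ring
  linarith

/-- The regret of the optimistic action is at most the uncertainty of the exploration policy. -/
lemma le_add_uncertainty_of_confident [MeasurableSpace X] [MeasurableSpace A] {β : ℕ → ℝ}
    (hplan : IsEluderPlanner F β T plan) (hls : IsLeastSquares F ls)
    (hopt : IsOptimistic F β T ls opt) (hf : fstar ∈ F) {t : ℕ} (ht : t < T) (hβ : 0 ≤ β (t + 1))
    (hconf : ∑ i ∈ Finset.range t, (ls t (samplerData plan x fstar xs ξ t)
      (samplePoint plan x xs i) - fstar (samplePoint plan x xs i)) ^ 2 ≤ β (t + 1) ^ 2)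
    (htrans : ∀ f ∈ F, ∑ i ∈ Finset.range t,
        (f (samplePoint plan x xs i) - fstar (samplePoint plan x xs i)) ^ 2 ≤ 4 * β (t + 1) ^ 2 →
      ∑ i ∈ Finset.range t, (f (planPoint plan x i) - fstar (planPoint plan x i)) ^ 2 ≤
        16 * β (t + 1) ^ 2) (y : X) (a : A) :
    fstar (y, a) ≤ fstar (y, opt t (samplerData plan x fstar xs ξ t) y) +
      uncertainty F (4 * β (t + 1)) (planData plan x t)
        (y, plan t (planData plan x t) y) := by
  set D := samplerData plan x fstar xs ξ t
  set b := opt t D y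
  have hD : (fun i => (D i).1) = fun i : Fin t => samplePoint plan x xs i := rfl
  have h1 : fstar (y, a) ≤ optimisticValue F (ls t D) (β (t + 1)) (fun i => (D i).1) (y, a) := by
    refine le_csSup (optimisticValue_set_finite F _ _ _ _).bddAbove ⟨fstar, hf, ?_, rfl⟩
    rw [hD, dataNorm_le_iff _ _ _ hβ]
    exact hconf
  have h2 := hopt.argmax t ht D y a
  obtain ⟨f, hfF, hfd, hfv⟩ : ∃ f ∈ F, dataNorm (ls t D) f (fun i => (D i).1) ≤ β (t + 1) ∧
      optimisticValue F (ls t D) (β (t + 1)) (fun i => (D i).1) (y, b) = f (y, b) := by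
    refine Set.Nonempty.csSup_mem (s := {v : ℝ | ∃ f ∈ F,
      dataNorm (ls t D) f (fun i => (D i).1) ≤ β (t + 1) ∧ v = f (y, b)})
      ⟨_, ls t D, (hls t D).1, (dataNorm_self _ _).trans_le hβ, rfl⟩
      (optimisticValue_set_finite F _ _ _ _)
  rw [hD, dataNorm_le_iff _ _ _ hβ] at hfd
  -- Both `f` and `fstar` are within `β` of the fit, and `(u - v)² ≤ 2u² + 2v²`.
  have h3 : ∑ i ∈ Finset.range t,
      (f (samplePoint plan x xs i) - fstar (samplePoint plan x xs i)) ^ 2 ≤ 4 * β (t + 1) ^ 2 := by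
    calc ∑ i ∈ Finset.range t,
          (f (samplePoint plan x xs i) - fstar (samplePoint plan x xs i)) ^ 2
        ≤ ∑ i ∈ Finset.range t,
          (2 * (ls t D (samplePoint plan x xs i) - f (samplePoint plan x xs i)) ^ 2 +
          2 * (ls t D (samplePoint plan x xs i) - fstar (samplePoint plan x xs i)) ^ 2) := by
          refine Finset.sum_le_sum fun i _ => ?_
          nlinarith [sq_nonneg ((ls t D (samplePoint plan x xs i) - f (samplePoint plan x xs i)) +
            (ls t D (samplePoint plan x xs i) - fstar (samplePoint plan x xs i)))]
      _ ≤ 4 * β (t + 1) ^ 2 := by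
          rw [Finset.sum_add_distrib, ← Finset.mul_sum, ← Finset.mul_sum]
          linarith
  have h4 : dataNorm f fstar (planData plan x t) ≤ 4 * β (t + 1) := by
    rw [planData_eq, dataNorm_le_iff _ _ _ (by positivity)]
    refine (htrans f hfF h3).trans (le_of_eq (by ring))
  -- The pair `(f, fstar)` is admissible for the planner, so the overestimation at `b` is at most
  -- the uncertainty there, which the planner's own action maximizes.
  have h5 := le_uncertainty hfF hf h4 (y, b)
  have h6 := hplan.argmax t ht (planData plan x t) y b
  linarith

end Regret

/-! ### Policy values and mixtures -/

section Value

lemma isProbabilityMeasure_uniformMixture {X A : Type*} [MeasurableSpace A] {T : ℕ} (hT : 1 ≤ T) (p : ℕ → X → A) (x : X) :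
    IsProbabilityMeasure (uniformMixture T p x) := by
  refine ⟨?_⟩
  simp only [uniformMixture, Measure.smul_apply, Measure.finsetSum_apply, measure_univ,
    Finset.sum_const, Finset.card_range, smul_eq_mul, nsmul_eq_mul, mul_one]
  exact ENNReal.inv_mul_cancel (by positivity) (ENNReal.natCast_ne_top T)

variable {X A : Type*} [MeasurableSpace X] [MeasurableSpace A] {P : Measure X}
  [IsProbabilityMeasure P] {f : X × A → ℝ} {B : ℝ}

lemma abs_policyValue_le (hf : ∀ z, |f z| ≤ B) {π : X → Measure A}
    (hπ : ∀ x, IsProbabilityMeasure (π x)) : |policyValue P f π| ≤ B := by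
  have h1 : ∀ x, ‖∫ a, f (x, a) ∂(π x)‖ ≤ B := fun x => by
    have := norm_integral_le_of_norm_le_const (μ := π x) (f := fun a => f (x, a)) (C := B)
      (ae_of_all _ fun a => hf _)
    simpa using this
  have := norm_integral_le_of_norm_le_const (μ := P) (C := B) (ae_of_all _ h1)
  simpa [policyValue] using this

lemma integral_uniformMixture (hfm : Measurable f) {T : ℕ} (p : ℕ → X → A) (x : X) :
    ∫ a, f (x, a) ∂(uniformMixture T p x) = (T : ℝ)⁻¹ * ∑ t ∈ Finset.range T, f (x, p t x) := by
  have hm : StronglyMeasurable fun a => f (x, a) :=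
    (hfm.comp measurable_prodMk_left).stronglyMeasurable
  rw [uniformMixture, integral_smul_measure, integral_finsetSum_measure]
  · simp [integral_dirac' _ _ hm]
  · exact fun t _ => (integrable_dirac' hm (by simp))

/-- A pointwise regret bound gives a bound on the suboptimality of the mixture. -/
lemma policyValue_le_uniformMixture_add (hfm : Measurable f) (hf : ∀ z, |f z| ≤ B)
    {T : ℕ} (hT : 1 ≤ T) {p : ℕ → X → A} (hp : ∀ t < T, Measurable (p t)) {w : ℕ → X → ℝ}
    (hw : ∀ t < T, Integrable (w t) P)
    (h : ∀ t < T, ∀ x a, f (x, a) ≤ f (x, p t x) + w t x)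
    (π : Kernel X A) [IsMarkovKernel π] :
    policyValue P f π ≤ policyValue P f (uniformMixture T p) +
      (∑ t ∈ Finset.range T, ∫ x, w t x ∂P) / T := by
  have hT0 : (0 : ℝ) < T := by exact_mod_cast hT
  have hint1 : Integrable (fun x => ∫ a, f (x, a) ∂(π x)) P := by
    refine Integrable.of_bound
      (hfm.stronglyMeasurable.integral_kernel_prod_right' (κ := π)).aestronglyMeasurable B
      (ae_of_all _ fun x => ?_)
    have := norm_integral_le_of_norm_le_const (μ := π x) (f := fun a => f (x, a)) (C := B)
      (ae_of_all _ fun a => hf _)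
    simpa using this
  have hint2 : ∀ t ∈ Finset.range T, Integrable (fun x => f (x, p t x)) P := fun t ht =>
    Integrable.of_bound (hfm.comp (measurable_id.prodMk
      (hp t (Finset.mem_range.1 ht)))).aestronglyMeasurable B (ae_of_all _ fun x => hf _)
  have hint3 : ∀ t ∈ Finset.range T, Integrable (w t) P := fun t ht =>
    hw t (Finset.mem_range.1 ht)
  have hpt : ∀ x, ∫ a, f (x, a) ∂(π x) ≤
      (T : ℝ)⁻¹ * ∑ t ∈ Finset.range T, f (x, p t x) +
        (T : ℝ)⁻¹ * ∑ t ∈ Finset.range T, w t x := by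
    intro x
    have h1 : ∀ a, f (x, a) ≤ (T : ℝ)⁻¹ * ∑ t ∈ Finset.range T, f (x, p t x) +
        (T : ℝ)⁻¹ * ∑ t ∈ Finset.range T, w t x := by
      intro a
      rw [← mul_add, ← Finset.sum_add_distrib, le_inv_mul_iff₀ hT0]
      calc (T : ℝ) * f (x, a) = ∑ _t ∈ Finset.range T, f (x, a) := by simp
        _ ≤ _ := Finset.sum_le_sum fun t ht => h t (Finset.mem_range.1 ht) x a
    have hi : Integrable (fun a => f (x, a)) (π x) :=
      Integrable.of_bound (hfm.comp measurable_prodMk_left).aestronglyMeasurable B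
        (ae_of_all _ fun a => hf _)
    have := integral_mono hi (integrable_const _) h1
    simpa using this
  have hs1 := (integrable_finsetSum _ hint2).const_mul (T : ℝ)⁻¹
  have hs2 := (integrable_finsetSum _ hint3).const_mul (T : ℝ)⁻¹
  calc policyValue P f π
      ≤ ∫ x, ((T : ℝ)⁻¹ * ∑ t ∈ Finset.range T, f (x, p t x) +
        (T : ℝ)⁻¹ * ∑ t ∈ Finset.range T, w t x) ∂P := integral_mono hint1 (hs1.add hs2) hpt
    _ = policyValue P f (uniformMixture T p) + (∑ t ∈ Finset.range T, ∫ x, w t x ∂P) / T := by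
        rw [integral_add hs1 hs2, integral_const_mul (T : ℝ)⁻¹ fun x => ∑ t ∈ Finset.range T, w t x,
          integral_finsetSum _ hint3, policyValue, div_eq_inv_mul]
        simp_rw [integral_uniformMixture hfm]

end Value

/-! ### Union bound and logarithmic factors -/

section Union

/-- Union bound over the steps and over a finite family of events. -/
lemma measure_biUnion_steps_le {Ω ι : Type*} [MeasurableSpace Ω] {μ : Measure Ω} (I : Finset ι)
    (s : ℕ → ι → Set Ω) (T : ℕ) {N δ : ℝ} (hN : 0 < N) (hδ : 0 ≤ δ) (hI : (I.card : ℝ) ≤ N)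
    (hs : ∀ n < T, ∀ i ∈ I,
      μ (s n i) ≤ ENNReal.ofReal (δ / (4 * N * ((n + 1) * (n + 2))))) :
    μ (⋃ n ∈ Finset.range T, ⋃ i ∈ I, s n i) ≤ ENNReal.ofReal (δ / 4) := by
  -- The weights over the steps telescope to a sum below one.
  have htel : ∀ T : ℕ, ∑ n ∈ Finset.range T, 1 / (((n : ℝ) + 1) * (n + 2)) = 1 - 1 / (T + 1) := by
    intro T
    induction T with
    | zero => simp
    | succ T ih =>
      rw [Finset.sum_range_succ, ih]
      push_cast
      field_simp
      ring
  calc μ (⋃ n ∈ Finset.range T, ⋃ i ∈ I, s n i)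
      ≤ ∑ n ∈ Finset.range T, ∑ i ∈ I, μ (s n i) :=
        (measure_biUnion_finset_le _ _).trans
          (Finset.sum_le_sum fun n _ => measure_biUnion_finset_le _ _)
    _ ≤ ∑ n ∈ Finset.range T, ENNReal.ofReal (δ / 4 * (1 / (((n : ℝ) + 1) * (n + 2)))) := by
        refine Finset.sum_le_sum fun n hn => ?_
        refine (Finset.sum_le_card_nsmul _ _ _ fun i hi =>
          hs n (Finset.mem_range.1 hn) i hi).trans ?_
        rw [nsmul_eq_mul, ← ENNReal.ofReal_natCast, ← ENNReal.ofReal_mul (Nat.cast_nonneg _)]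
        refine ENNReal.ofReal_le_ofReal ?_
        calc (I.card : ℝ) * (δ / (4 * N * ((n + 1) * (n + 2))))
            ≤ N * (δ / (4 * N * ((n + 1) * (n + 2)))) := by gcongr
          _ = δ / 4 * (1 / (((n : ℝ) + 1) * (n + 2))) := by field_simp
    _ = ENNReal.ofReal (δ / 4 * (1 - 1 / (T + 1))) := by
        rw [← htel, Finset.mul_sum, ENNReal.ofReal_sum_of_nonneg fun n _ => by positivity]
    _ ≤ ENNReal.ofReal (δ / 4) := by
        refine ENNReal.ofReal_le_ofReal (mul_le_of_le_one_right (by positivity) ?_)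
        have : (0 : ℝ) ≤ 1 / (T + 1) := by positivity
        linarith

/-- The logarithm of the inverse failure probability allotted to each event of step `t`. -/
noncomputable def logFailure (N δ t : ℝ) : ℝ := Real.log (4 * N ^ 2 * (t * (t + 1)) / δ)

lemma exp_neg_logFailure {N δ t : ℝ} (hN : 0 < N) (hδ : 0 < δ) (ht : 0 < t) :
    Real.exp (-logFailure N δ t) = δ / (4 * N ^ 2 * (t * (t + 1))) := by
  rw [logFailure, Real.exp_neg, Real.exp_log (by positivity), inv_div]

/-- Crude powers suffice: `4N²t(t+1) ≤ 8N²t² ≤ (Nt)⁵` because `N³ ≥ 8`, and `δ⁵ ≤ δ`. This needs `N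
≥ 2`. -/
lemma logFailure_le {N δ t : ℝ} (hN : 2 ≤ N) (hδ : 0 < δ) (hδ1 : δ < 1) (ht : 1 ≤ t) :
    logFailure N δ t ≤ 5 * Real.log (N * t / δ) := by
  have hN0 : 0 < N := by linarith
  have ht0 : 0 < t := by linarith
  have h5 : 5 * Real.log (N * t / δ) = Real.log ((N * t / δ) ^ 5) := by
    rw [Real.log_pow]
    norm_num
  rw [h5, logFailure]
  refine Real.log_le_log (by positivity) ?_
  rw [div_pow]
  have hδ5 : δ ^ 5 ≤ δ := pow_le_of_le_one hδ.le hδ1.le (by norm_num)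
  have hnum : 4 * N ^ 2 * (t * (t + 1)) ≤ (N * t) ^ 5 := by
    have hN3 : (8 : ℝ) ≤ N ^ 3 := by
      calc (8 : ℝ) = 2 ^ 3 := by norm_num
        _ ≤ N ^ 3 := by gcongr
    have ht3 : (1 : ℝ) ≤ t ^ 3 := one_le_pow₀ ht
    calc 4 * N ^ 2 * (t * (t + 1)) ≤ 4 * N ^ 2 * (t * (t + t)) := by gcongr
      _ = N ^ 2 * t ^ 2 * (8 * 1) := by ring
      _ ≤ N ^ 2 * t ^ 2 * (N ^ 3 * t ^ 3) := by gcongr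
      _ = (N * t) ^ 5 := by ring
  gcongr

/-- Since `log 2 > 1/2`; allows terms without a logarithm to be absorbed into terms with one. -/
lemma half_le_log {N δ t : ℝ} (hN : 2 ≤ N) (hδ : 0 < δ) (hδ1 : δ < 1) (ht : 1 ≤ t) :
    1 / 2 ≤ Real.log (N * t / δ) := by
  have h : (2 : ℝ) ≤ N * t / δ := by
    rw [le_div_iff₀ hδ]
    nlinarith
  have := Real.log_le_log (by norm_num) h
  have := Real.log_two_gt_d9
  linarith

end Union

lemma confRadius_nonneg {Cbar B Bbar : ℝ} (hC : 0 ≤ Cbar) (hB : 0 ≤ B) (hBbar : 0 ≤ Bbar)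
    {X A : Type*} (F : Finset (X × A → ℝ)) (δ : ℝ) (t : ℕ) :
    0 ≤ confRadius Cbar B Bbar F δ t := by
  unfold confRadius
  positivity

lemma sq_confRadius {Cbar B Bbar : ℝ} {X A : Type*} {F : Finset (X × A → ℝ)} {δ : ℝ} {t : ℕ}
    (h : 0 ≤ Real.log ((F.card : ℝ) * t / δ)) :
    confRadius Cbar B Bbar F δ t ^ 2 =
      Cbar ^ 2 * (B + Bbar) ^ 2 * Real.log ((F.card : ℝ) * t / δ) := by
  rw [confRadius, mul_pow, mul_pow, Real.sq_sqrt h]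

/-! ### Optimality on the good event -/

section Deterministic

variable {X A : Type*} {F : Finset (X × A → ℝ)}
  {plan : (n : ℕ) → (Fin n → X × A) → X → A}
  {ls : (n : ℕ) → (Fin n → (X × A) × ℝ) → X × A → ℝ}
  {opt : (n : ℕ) → (Fin n → (X × A) × ℝ) → X → A}
  {fstar : X × A → ℝ} {B Bbar ε δ : ℝ} {T d : ℕ} {x xs : ℕ → X} {ξ : ℕ → ℝ}

/-- The width of the planner's confidence set at the action of the exploration policy. -/
noncomputable def explorationWidth (F : Finset (X × A → ℝ)) (β : ℕ → ℝ)
    (plan : (n : ℕ) → (Fin n → X × A) → X → A) (t : ℕ) (p : (Fin t → X × A) × X) : ℝ :=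
  uncertainty F (4 * β (t + 1)) p.1 (p.2, plan t p.1 p.2)

/-- The planner's total uncertainty along its own data. -/
lemma sum_explorationWidth_le {β : ℕ → ℝ} (hF : F.Nonempty) (hB : ∀ f ∈ F, ∀ z, |f z| ≤ B)
    (hβ : ∀ t, 0 ≤ β t) (hβT : ∀ t < T, β (t + 1) ≤ β T) (hβpos : 0 < β T) {η₀ η : ℝ}
    (hη : η₀ ≤ η) (hη0 : 0 < η) (hηB : η < 2 * B)
    (hd : eluderDim (F : Set (X × A → ℝ)) η₀ = d) :
    ∑ t ∈ Finset.range T, explorationWidth F β plan t (planData plan x t, x t) ≤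
      T * η + 2 * (4 * β T) ^ 2 * d / η + 2 * (2 * B) * d := by
  have hr : ∀ t, 0 ≤ 4 * β (t + 1) := fun t => mul_nonneg (by norm_num) (hβ _)
  refine sum_width_le (F : Set (X × A → ℝ)) (planPoint plan x) _ hη hη0 hηB (by positivity) hd
    (fun k _ => uncertainty_le hF (hr k) hB _ _) fun k hk v hv => ?_
  obtain ⟨f, hf, f', hf', hdist, hval⟩ := uncertainty_mem hF (hr k) (planData plan x k)
    (x k, plan k (planData plan x k) (x k))
  refine ⟨f, hf, f', hf', ?_, ?_⟩
  · rw [planData_eq, dataNorm_le_iff _ _ _ (hr k)] at hdist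
    refine hdist.trans ?_
    have := hβT k hk
    have := hr k
    gcongr
  · exact hv.trans_eq hval

variable [MeasurableSpace X] [MeasurableSpace A] {P : Measure X} [IsProbabilityMeasure P]

lemma measurable_explorationWidth {β : ℕ → ℝ} (hF : F.Nonempty) (hFm : ∀ f ∈ F, Measurable f)
    (hβ : ∀ t, 0 ≤ β t) (hplan : IsEluderPlanner F β T plan) {t : ℕ} (ht : t < T) :
    Measurable (explorationWidth F β plan t) := by
  have h := measurable_uncertainty (n := t) hF hFm
    (mul_nonneg (by norm_num : (0 : ℝ) ≤ 4) (hβ (t + 1)))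
  have hg : Measurable fun p : (Fin t → X × A) × X => (p.1, (p.2, plan t p.1 p.2)) :=
    measurable_fst.prodMk (measurable_snd.prodMk (hplan.measurable t ht))
  have heq : explorationWidth F β plan t =
      (fun q : (Fin t → X × A) × (X × A) => uncertainty F (4 * β (t + 1)) q.1 q.2) ∘
        fun p : (Fin t → X × A) × X => (p.1, (p.2, plan t p.1 p.2)) := by
    funext p
    simp only [explorationWidth, Function.comp_apply]
  rw [heq]
  exact h.comp hg

/-- If the regret of every optimistic action is at most the width of the exploration policy, then
the suboptimality of the output is at most the average expected width. -/
lemma isEpsOptimal_of_sum_width_le {β : ℕ → ℝ} (hF : F.Nonempty) (hFm : ∀ f ∈ F, Measurable f)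
    (hB : ∀ f ∈ F, ∀ z, |f z| ≤ B) (hf : fstar ∈ F) (hβ : ∀ t, 0 ≤ β t) (hT : 1 ≤ T)
    (hplan : IsEluderPlanner F β T plan) (hopt : IsOptimistic F β T ls opt)
    (h : ∀ t < T, ∀ y a, fstar (y, a) ≤ fstar (y, opt t (samplerData plan x fstar xs ξ t) y) +
      explorationWidth F β plan t (planData plan x t, y))
    (hsum : ∑ t ∈ Finset.range T, ∫ y, explorationWidth F β plan t (planData plan x t, y) ∂P ≤
      T * ε) :
    IsEpsOptimal P fstar ε (eluderPlanningPolicy plan opt fstar T x xs ξ) := by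
  intro π _
  have hr : ∀ t, 0 ≤ 4 * β (t + 1) := fun t => mul_nonneg (by norm_num) (hβ _)
  have key := policyValue_le_uniformMixture_add (P := P) (hFm _ hf) (hB _ hf) hT
    (p := fun t => opt t (samplerData plan x fstar xs ξ t))
    (fun t ht => (hopt.measurable t ht).comp measurable_prodMk_left)
    (w := fun t y => explorationWidth F β plan t (planData plan x t, y))
    (fun t ht => integrable_of_mem_Icc
      ((measurable_explorationWidth hF hFm hβ hplan ht).comp measurable_prodMk_left)
      (fun y => uncertainty_nonneg hF (hr t) _ _) (fun y => uncertainty_le hF (hr t) hB _ _)) h π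
  refine key.trans (add_le_add le_rfl ?_)
  rw [div_le_iff₀ (by exact_mod_cast hT), mul_comm]
  exact hsum

/-- The events on which the concentration inequalities hold imply that the output is optimal up to
`ε`. -/
lemma isEpsOptimal_of_concentration
    (hB : 0 < B) (hBbar : 0 < Bbar) (hε : 0 < ε) (hε2 : ε ≤ 2 * B) (hδ : 0 < δ) (hδ1 : δ < 1)
    (hT : 1 ≤ T) (hcard : 2 ≤ F.card) (hFm : ∀ f ∈ F, Measurable f)
    (hFB : ∀ f ∈ F, ∀ z, |f z| ≤ B) (hf : fstar ∈ F)
    (hplan : IsEluderPlanner F (confRadius 7 B Bbar F δ) T plan)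
    (hls : IsLeastSquares F ls)
    (hopt : IsOptimistic F (confRadius 7 B Bbar F δ) T ls opt)
    (hd : eluderDim (F : Set (X × A → ℝ)) (B / T) = d)
    (hTε : 10 ^ 6 * (max (max B Bbar) 1 ^ 2 * max (d : ℝ) 1 *
      Real.log ((F.card : ℝ) * T / δ)) / ε ^ 2 ≤ (T : ℝ))
    (hnoise : ∀ t < T, ∀ f ∈ F, ∑ i ∈ Finset.range t,
      ((f (samplePoint plan x xs i) - fstar (samplePoint plan x xs i)) * ξ i / (2 * Bbar ^ 2) -
        (f (samplePoint plan x xs i) - fstar (samplePoint plan x xs i)) ^ 2 / (8 * Bbar ^ 2)) <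
      logFailure F.card δ (t + 1 : ℕ))
    (hpair : ∀ t < T, ∀ f ∈ F, ∑ i ∈ Finset.range t,
      ((f (planPoint plan x i) - fstar (planPoint plan x i)) ^ 2 -
        2 * (f (samplePoint plan x xs i) - fstar (samplePoint plan x xs i)) ^ 2) /
          (8 * (4 * B ^ 2)) < logFailure F.card δ (t + 1 : ℕ))
    (hmean : ∑ t ∈ Finset.range T,
      (∫ y, explorationWidth F (confRadius 7 B Bbar F δ) plan t (planData plan x t, y) ∂P -
        2 * explorationWidth F (confRadius 7 B Bbar F δ) plan t (planData plan x t, x t)) /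
          (4 * (2 * B)) < logFailure F.card δ T) :
    IsEpsOptimal P fstar ε (eluderPlanningPolicy plan opt fstar T x xs ξ) := by
  set β := confRadius 7 B Bbar F δ with hβdef
  have hN : (2 : ℝ) ≤ F.card := by exact_mod_cast hcard
  have hF : F.Nonempty := ⟨fstar, hf⟩
  have hβ : ∀ t, 0 ≤ β t := fun t => confRadius_nonneg (by norm_num) hB.le hBbar.le F δ t
  have hL : ∀ t : ℕ, 1 ≤ t → 1 / 2 ≤ Real.log ((F.card : ℝ) * t / δ) := fun t ht =>
    half_le_log hN hδ hδ1 (by exact_mod_cast ht)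
  have hβsq : ∀ t : ℕ, 1 ≤ t →
      β t ^ 2 = 7 ^ 2 * (B + Bbar) ^ 2 * Real.log ((F.card : ℝ) * t / δ) := fun t ht =>
    sq_confRadius (by linarith [hL t ht])
  have hfail : ∀ t : ℕ, 1 ≤ t →
      logFailure F.card δ t ≤ 5 * Real.log ((F.card : ℝ) * t / δ) := fun t ht =>
    logFailure_le hN hδ hδ1 (by exact_mod_cast ht)
  have hβT : ∀ t < T, β (t + 1) ≤ β T := by
    intro t ht
    simp only [hβdef, confRadius]
    have h1 : ((t + 1 : ℕ) : ℝ) ≤ T := by exact_mod_cast ht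
    have h2 : (0 : ℝ) < (F.card : ℝ) * (t + 1 : ℕ) / δ := by
      have : (0 : ℝ) < F.card := by linarith
      positivity
    gcongr
  have hβTpos : 0 < β T := by
    have h1 := hL T hT
    have h2 : 0 < β T ^ 2 := by
      rw [hβsq T hT]
      have : 0 < Real.log ((F.card : ℝ) * T / δ) := by linarith
      positivity
    exact (hβ T).lt_of_ne' fun h => by simp [h] at h2
  refine isEpsOptimal_of_sum_width_le hF hFm hFB hf hβ hT hplan hopt (fun t ht y a => ?_) ?_
  · refine le_add_uncertainty_of_confident hplan hls hopt hf ht (hβ _) ?_ (fun f hfF hclose => ?_)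
      y a
    · set fhat := ls t (samplerData plan x fstar xs ξ t) with hfhat
      have h1 := hls.sum_sq_le (plan := plan) (x := x) (xs := xs) (ξ := ξ) hf t
      have h2 := hnoise t ht fhat (hls _ _).1
      rw [← hfhat] at h1
      rw [Finset.sum_sub_distrib, ← Finset.sum_div, ← Finset.sum_div] at h2
      have h3 := h2.trans_le (hfail (t + 1) (by omega))
      have h4 := hL (t + 1) (by omega)
      rw [hβsq (t + 1) (by omega)]
      set S := ∑ i ∈ Finset.range t,
        (fhat (samplePoint plan x xs i) - fstar (samplePoint plan x xs i)) ^ 2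
      set R := ∑ i ∈ Finset.range t,
        (fhat (samplePoint plan x xs i) - fstar (samplePoint plan x xs i)) * ξ i
      set L := Real.log ((F.card : ℝ) * (t + 1 : ℕ) / δ)
      have e : R / (2 * Bbar ^ 2) - S / (8 * Bbar ^ 2) = (4 * R - S) / (8 * Bbar ^ 2) := by
        field_simp
        ring
      rw [e, div_lt_iff₀ (by positivity)] at h3
      -- With `S ≤ 2R`, the noise event gives `S ≤ 4R - S < 8 Bbar² · 5L`; the constant 7 is chosen
      -- so that `7² ≥ 40`.
      have h5 : 40 * (Bbar ^ 2 * L) ≤ 7 ^ 2 * (B + Bbar) ^ 2 * L := by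
        have : 40 * Bbar ^ 2 ≤ 7 ^ 2 * (B + Bbar) ^ 2 := by nlinarith [mul_pos hB hBbar]
        nlinarith
      linarith
    · have h2 := (hpair t ht f hfF).trans_le (hfail (t + 1) (by omega))
      have h4 := hL (t + 1) (by omega)
      rw [← Finset.sum_div, Finset.sum_sub_distrib, ← Finset.mul_sum,
        div_lt_iff₀ (by positivity)] at h2
      have h6 := hβsq (t + 1) (by omega)
      -- The deviation `32B² · 5L` is at most `8β²`; added to twice `4β²` it gives the required
      -- `16β²`.
      have h5 : 160 * (B ^ 2 * Real.log ((F.card : ℝ) * (t + 1 : ℕ) / δ)) ≤ 8 * β (t + 1) ^ 2 := by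
        rw [h6]
        have : 160 * B ^ 2 ≤ 8 * (7 ^ 2 * (B + Bbar) ^ 2) := by nlinarith [mul_pos hB hBbar]
        nlinarith
      linarith
  · have hLT := hL T hT
    have hfT := hmean.trans_le (hfail T hT)
    have hβ2 := hβsq T hT
    have hT0 : (0 : ℝ) < T := by exact_mod_cast hT
    rw [← Finset.sum_div, Finset.sum_sub_distrib, ← Finset.mul_sum,
      div_lt_iff₀ (by positivity)] at hfT
    set L := Real.log ((F.card : ℝ) * T / δ)
    set M := max (max B Bbar) 1
    have hBM : B ≤ M := (le_max_left _ _).trans (le_max_left _ _)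
    have hBbM : Bbar ≤ M := (le_max_right _ _).trans (le_max_left _ _)
    set D := max (d : ℝ) 1
    have hdD : (d : ℝ) ≤ D := le_max_left _ _
    have hD1 : 1 ≤ D := le_max_right _ _
    have hM0 : 0 < M := hB.trans_le hBM
    have hL0 : 0 < L := by linarith
    have hQ : 10 ^ 6 * (M ^ 2 * D * L) / ε ≤ T * ε := by
      rw [div_le_iff₀ (by positivity)] at hTε
      rw [div_le_iff₀ hε]
      linarith
    -- Every error term is measured in units of `Q`. Terms linear in `B` fit because `ε ≤ 2B` gives
    -- `B ≤ 2B²/ε`.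
    set Q := M ^ 2 * D * L / ε with hQdef
    have hQ' : 10 ^ 6 * Q ≤ T * ε := by rw [hQdef, ← mul_div_assoc]; exact hQ
    have hB2 : B ≤ 2 * (B ^ 2 / ε) := by
      rw [← mul_div_assoc, le_div_iff₀ hε]
      nlinarith
    have hBD : B ^ 2 / ε * D ≤ 2 * Q := by
      have : B ^ 2 / ε * D ≤ M ^ 2 / ε * D * (2 * L) := by
        calc B ^ 2 / ε * D ≤ M ^ 2 / ε * D := by gcongr
          _ ≤ M ^ 2 / ε * D * (2 * L) := le_mul_of_one_le_right (by positivity) (by linarith)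
      calc B ^ 2 / ε * D ≤ M ^ 2 / ε * D * (2 * L) := this
        _ = 2 * Q := by rw [hQdef]; ring
    have hBd : B * D ≤ 4 * Q := by
      calc B * D ≤ 2 * (B ^ 2 / ε) * D := by gcongr
        _ ≤ 4 * Q := by linarith
    have hBQ : B ≤ 4 * Q := by
      refine le_trans ?_ hBd
      exact le_mul_of_one_le_right hB.le hD1
    have hBL : B * L ≤ 2 * Q := by
      calc B * L ≤ 2 * (B ^ 2 / ε) * L := by gcongr
        _ ≤ 2 * (M ^ 2 / ε) * L * D := by
            refine le_trans ?_ (le_mul_of_one_le_right (by positivity) hD1)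
            gcongr
        _ = 2 * Q := by rw [hQdef]; ring
    have hr : (4 * β T) ^ 2 * d / ε ≤ 3136 * Q := by
      calc (4 * β T) ^ 2 * d / ε = 784 * (B + Bbar) ^ 2 * L * d / ε := by
            rw [mul_pow, hβ2]; ring
        _ ≤ 784 * (M + M) ^ 2 * L * D / ε := by gcongr
        _ = 3136 * Q := by rw [hQdef]; ring
    -- The scale `ε/8` is admissible: `8B ≤ 32Q ≤ Tε` and `ε ≤ 2B`. After doubling, the widths cost
    -- `Tε/4` plus about `10⁵ Q`, and the mean deviation `40BL` costs `80Q`; the total stays below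
    -- `Tε` as `10⁶ Q ≤ Tε`.
    have hsum := sum_explorationWidth_le (plan := plan) (x := x) (T := T) (β := β) hF hFB hβ hβT
      hβTpos (η₀ := B / T) (η := ε / 8) (by rw [div_le_iff₀ hT0]; linarith) (by positivity)
      (by linarith) hd
    have e1 : 2 * (4 * β T) ^ 2 * (d : ℝ) / (ε / 8) = 16 * ((4 * β T) ^ 2 * d / ε) := by
      field_simp
      ring
    rw [e1] at hsum
    have hBd' : B * d ≤ 4 * Q := le_trans (by gcongr) hBd
    linarith

end Deterministic

end EluderPlanning

/-! ### The main theorem: trivial cases and union of bad events -/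

theorem theorem1 :
    ∃ Cbar : ℝ, 0 < Cbar ∧ ∃ c : ℝ, 0 < c ∧
      ∀ {X : Type*} {A : Type*} {Ω : Type*}
        [MeasurableSpace X] [MeasurableSpace A] [MeasurableSpace Ω]
        (μ : Measure Ω) [IsProbabilityMeasure μ] (P : Measure X) [IsProbabilityMeasure P]
        (F : Finset (X × A → ℝ)) (fstar : X × A → ℝ) (B Bbar ε δ : ℝ) (m T d : ℕ)
        (x xs : ℕ → Ω → X) (ξ : ℕ → Ω → ℝ)
        (plan : (n : ℕ) → (Fin n → X × A) → X → A)
        (ls : (n : ℕ) → (Fin n → (X × A) × ℝ) → X × A → ℝ)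
        (opt : (n : ℕ) → (Fin n → (X × A) × ℝ) → X → A),
        0 < B → 0 < Bbar → 0 < ε → 0 < δ → δ < 1 → 1 ≤ T → T ≤ m →
        (∀ f ∈ F, Measurable f) → (∀ f ∈ F, ∀ z, |f z| ≤ B) → fstar ∈ F →
        IsEnvironment μ P Bbar m T x xs ξ →
        IsEluderPlanner F (confRadius Cbar B Bbar F δ) T plan →
        IsLeastSquares F ls →
        IsOptimistic F (confRadius Cbar B Bbar F δ) T ls opt →
        eluderDim (F : Set (X × A → ℝ)) (B / T) = (d : ℕ∞) →
        c * (max (max B Bbar) 1 ^ 2 * max (d : ℝ) 1 * Real.log ((F.card : ℝ) * T / δ)) / ε ^ 2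
          ≤ (T : ℝ) →
        ENNReal.ofReal (1 - δ) ≤
          μ {ω | IsEpsOptimal P fstar ε
            (eluderPlanningPolicy plan opt fstar T
              (fun i => x i ω) (fun t => xs t ω) (fun t => ξ t ω))} := by
  refine ⟨7, by norm_num, 10 ^ 6, by norm_num, ?_⟩
  intro X A Ω _ _ _ μ _ P _ F fstar B Bbar ε δ m T d x xs ξ plan ls opt hB hBbar hε hδ hδ1 hT hTm
    hFm hFB hf henv hplan hls hopt hd hTε
  have hcertain : (∀ ω, IsEpsOptimal P fstar ε (eluderPlanningPolicy plan opt fstar T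
      (fun i => x i ω) (fun t => xs t ω) (fun t => ξ t ω))) → ENNReal.ofReal (1 - δ) ≤
      μ {ω | IsEpsOptimal P fstar ε (eluderPlanningPolicy plan opt fstar T
        (fun i => x i ω) (fun t => xs t ω) (fun t => ξ t ω))} := by
    intro h
    rw [Set.eq_univ_of_forall (s := {ω | IsEpsOptimal P fstar ε (eluderPlanningPolicy plan opt
      fstar T (fun i => x i ω) (fun t => xs t ω) (fun t => ξ t ω))}) h, measure_univ,
      ← ENNReal.ofReal_one]
    exact ENNReal.ofReal_le_ofReal (by linarith)
  have hF : F.Nonempty := ⟨fstar, hf⟩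
  have hβ : ∀ t, 0 ≤ confRadius 7 B Bbar F δ t := fun t =>
    confRadius_nonneg (by norm_num) hB.le hBbar.le F δ t
  -- All values lie in `[-B, B]`, so a larger `ε` is trivial.
  rcases lt_or_ge (2 * B) ε with hεB | hεB
  · refine hcertain fun ω π hπ => ?_
    have h1 := abs_le.1 (abs_policyValue_le (P := P) (hFB _ hf) (fun y => hπ.isProbabilityMeasure y))
    have h2 := abs_le.1 (abs_policyValue_le (P := P) (hFB _ hf)
      (isProbabilityMeasure_uniformMixture hT fun t => opt t (samplerData plan (fun i => x i ω) fstar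
        (fun t => xs t ω) (fun t => ξ t ω) t)))
    have h3 : -B ≤ policyValue P fstar (eluderPlanningPolicy plan opt fstar T
      (fun i => x i ω) (fun t => xs t ω) (fun t => ξ t ω)) := h2.1
    linarith
  -- A singleton class has zero widths and an exact fit; it is split off because the logarithmic
  -- bounds need `N ≥ 2`.
  rcases lt_or_ge F.card 2 with hcard | hcard
  · have hsingle : ∀ f ∈ F, f = fstar := fun f hfF =>
      Finset.card_le_one.1 (by omega) f hfF fstar hf
    refine hcertain fun ω => isEpsOptimal_of_sum_width_le hF hFm hFB hf hβ hT hplan hopt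
      (fun t ht y a => ?_) ?_
    · refine le_add_uncertainty_of_confident hplan hls hopt hf ht (hβ _) ?_ (fun f hfF _ => ?_) y a
      · rw [hsingle _ (hls t _).1]
        simpa using sq_nonneg (confRadius 7 B Bbar F δ (t + 1))
      · rw [hsingle f hfF]
        simpa using sq_nonneg (confRadius 7 B Bbar F δ (t + 1))
    · have hzero : ∀ (t : ℕ) p, explorationWidth F (confRadius 7 B Bbar F δ) plan t p = 0 := by
        intro t p
        obtain ⟨f, hfF, f', hf'F, -, h⟩ := uncertainty_mem hF
          (mul_nonneg (by norm_num : (0 : ℝ) ≤ 4) (hβ (t + 1))) p.1 (p.2, plan t p.1 p.2)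
        rw [explorationWidth, h, hsingle f hfF, hsingle f' hf'F, sub_self]
      simp only [hzero, integral_zero, Finset.sum_const_zero]
      positivity
  have hN : (0 : ℝ) < F.card := by exact_mod_cast (by omega : 0 < F.card)
  have hN1 : (1 : ℝ) ≤ F.card := by exact_mod_cast (by omega : 1 ≤ F.card)
  let w := explorationWidth F (confRadius 7 B Bbar F δ) plan
  let E₁ : ℕ → (X × A → ℝ) → Set Ω := fun t f => {ω | logFailure F.card δ (t + 1 : ℕ) ≤
    ∑ i ∈ Finset.range t,
      ((f (samplePoint plan (fun i => x i ω) (fun i => xs i ω) i) -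
          fstar (samplePoint plan (fun i => x i ω) (fun i => xs i ω) i)) * ξ i ω / (2 * Bbar ^ 2) -
        (f (samplePoint plan (fun i => x i ω) (fun i => xs i ω) i) -
          fstar (samplePoint plan (fun i => x i ω) (fun i => xs i ω) i)) ^ 2 / (8 * Bbar ^ 2))}
  let E₂ : ℕ → (X × A → ℝ) → Set Ω := fun t f => {ω | logFailure F.card δ (t + 1 : ℕ) ≤
    ∑ i ∈ Finset.range t,
      ((f (planPoint plan (fun i => x i ω) i) - fstar (planPoint plan (fun i => x i ω) i)) ^ 2 -
        2 * (f (samplePoint plan (fun i => x i ω) (fun i => xs i ω) i) -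
          fstar (samplePoint plan (fun i => x i ω) (fun i => xs i ω) i)) ^ 2) / (8 * (4 * B ^ 2))}
  let E₃ : Set Ω := {ω | logFailure F.card δ T ≤ ∑ t ∈ Finset.range T,
    (∫ y, w t (planData plan (fun i => x i ω) t, y) ∂P -
      2 * w t (planData plan (fun i => x i ω) t, x t ω)) / (4 * (2 * B))}
  have hprob : ∀ t : ℕ, 1 ≤ t → Real.exp (-logFailure F.card δ t) =
      δ / (4 * (F.card : ℝ) ^ 2 * ((t : ℝ) * (t + 1))) := fun t ht =>
    exp_neg_logFailure hN hδ (by exact_mod_cast ht)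
  have hprob' : ∀ t : ℕ, Real.exp (-logFailure F.card δ (t + 1 : ℕ)) =
      δ / (4 * (F.card : ℝ) ^ 2 * (((t : ℝ) + 1) * (t + 2))) := by
    intro t
    rw [hprob (t + 1) (by omega)]
    push_cast
    ring_nf
  -- Each event is allotted a share with `N²` in the denominator, while the union over `F` costs
  -- only `N`.
  have hcardN : (F.card : ℝ) ≤ (F.card : ℝ) ^ 2 := le_self_pow₀ hN1 two_ne_zero
  have h1 : μ (⋃ t ∈ Finset.range T, ⋃ f ∈ F, E₁ t f) ≤ ENNReal.ofReal (δ / 4) := by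
    refine measure_biUnion_steps_le F E₁ T (by positivity) hδ.le hcardN fun t ht f hfF => ?_
    rw [← hprob' t]
    exact henv.measure_noise_ge_le hBbar hTm hplan.measurable
      (g := fun z => f z - fstar z) ((hFm f hfF).sub (hFm _ hf)) ht.le _
  have h2 : μ (⋃ t ∈ Finset.range T, ⋃ f ∈ F, E₂ t f) ≤ ENNReal.ofReal (δ / 4) := by
    refine measure_biUnion_steps_le F E₂ T (by positivity) hδ.le hcardN fun t ht f hfF => ?_
    rw [← hprob' t]
    refine henv.measure_plan_sub_sample_ge_le hTm hplan.measurable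
      (Y := fun z => (f z - fstar z) ^ 2) (((hFm f hfF).sub (hFm _ hf)).pow_const 2)
      (by positivity) (fun z => sq_nonneg _) (fun z => ?_) ht.le _
    have ha := abs_le.1 (hFB f hfF z)
    have hb := abs_le.1 (hFB fstar hf z)
    nlinarith
  have h3 : μ E₃ ≤ ENNReal.ofReal (δ / 4) := by
    have hr : ∀ t, 0 ≤ 4 * confRadius 7 B Bbar F δ (t + 1) := fun t =>
      mul_nonneg (by norm_num) (hβ _)
    refine (henv.measure_mean_sub_plan_ge_le (P := P) hTm hplan.measurable (w := w)
      (fun t ht => measurable_explorationWidth hF hFm hβ hplan ht) (M := 2 * B) (by positivity)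
      (fun t p => uncertainty_nonneg hF (hr t) _ _)
      (fun t p => uncertainty_le hF (hr t) hFB _ _) le_rfl _).trans ?_
    rw [hprob T hT]
    refine ENNReal.ofReal_le_ofReal ?_
    have hT1 : (1 : ℝ) ≤ T := by exact_mod_cast hT
    have hN2 : (1 : ℝ) ≤ (F.card : ℝ) ^ 2 := one_le_pow₀ hN1
    have h4 : (1 : ℝ) ≤ (F.card : ℝ) ^ 2 * (T * (T + 1)) :=
      one_le_mul_of_one_le_of_one_le hN2 (one_le_mul_of_one_le_of_one_le hT1 (by linarith))
    gcongr
    linarith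
  set G := {ω | IsEpsOptimal P fstar ε (eluderPlanningPolicy plan opt fstar T
    (fun i => x i ω) (fun t => xs t ω) (fun t => ξ t ω))} with hG
  -- Covering the whole space and using subadditivity avoids any measurability claim about `G`.
  have hcover : (Set.univ : Set Ω) ⊆ G ∪ ((⋃ t ∈ Finset.range T, ⋃ f ∈ F, E₁ t f) ∪
      (⋃ t ∈ Finset.range T, ⋃ f ∈ F, E₂ t f) ∪ E₃) := by
    intro ω _
    by_contra hω
    simp only [Set.mem_union, not_or, Set.mem_iUnion, not_exists, Finset.mem_range] at hω
    obtain ⟨hωG, ⟨hω1, hω2⟩, hω3⟩ := hω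
    exact hωG (isEpsOptimal_of_concentration hB hBbar hε hεB hδ hδ1 hT hcard hFm hFB hf hplan hls
      hopt hd hTε (fun t ht f hfF => not_le.1 (hω1 t ht f hfF))
      (fun t ht f hfF => not_le.1 (hω2 t ht f hfF)) (not_le.1 hω3))
  have hbad : μ ((⋃ t ∈ Finset.range T, ⋃ f ∈ F, E₁ t f) ∪
      (⋃ t ∈ Finset.range T, ⋃ f ∈ F, E₂ t f) ∪ E₃) ≤ ENNReal.ofReal δ := by
    refine (measure_union_le _ _).trans ((add_le_add ((measure_union_le _ _).trans
      (add_le_add h1 h2)) h3).trans ?_)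
    rw [← ENNReal.ofReal_add (by positivity) (by positivity),
      ← ENNReal.ofReal_add (by positivity) (by positivity)]
    exact ENNReal.ofReal_le_ofReal (by linarith)
  have htotal : 1 ≤ μ G + ENNReal.ofReal δ := by
    calc (1 : ℝ≥0∞) = μ Set.univ := measure_univ.symm
      _ ≤ μ G + μ _ := (measure_mono hcover).trans (measure_union_le _ _)
      _ ≤ μ G + ENNReal.ofReal δ := by gcongr
  rw [ENNReal.ofReal_sub _ hδ.le, ENNReal.ofReal_one]
  exact tsub_le_iff_right.2 htotal
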